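/- Let $X$ be a compact Hausdorff space, let $\gamma=(\gamma_1,\dots,\gamma_N)$ be a finite family of continuous maps $X\to X$, and let $\mathbb X\subseteq X$. Assume: (i) $\mathbb X$ is dense in $X$, and $\gamma_k(\mathbb X)\subseteq\mathbb X$ and $\gamma_k^{-1}(\mathbb X)\subseteq\mathbb X$ for all $k$; (ii) the sets $\gamma_1(\mathbb X),\dots,\gamma_N(\mathbb X)$ are pairwise disjoint; (iii) each $\gamma_k$ is injective on $\mathbb X$; (iv) every $\gamma_k\colon X\to X$ is a topological embedding; (v) (open set condition) there is a dense open set $U\subseteq X$ such that $\gamma_1(U),\dots,\gamma_N(U)$ are pairwise disjoint open subsets of $X$ contained in $U$, and moreover $\mathbb X\subseteq U$; (vi) $\mathbb X$ is comeager in $X$. Let $A=C(X)$, let $G=\bigcup_k\{(x,y)\in X\times X: x=\gamma_k(y)\}$ and $E=C(G)$. Let $M_{\mathbb X}$ be the algebra of bounded operators on $\ell^2(\mathbb X)$, with standard basis $(e_x)_{x\in\mathbb X}$, and define $\rho_A\colon A\to M_{\mathbb X}$ and $\rho_E\colon E\to M_{\mathbb X}$ by $\rho_A(a)e_x=a(x)e_x$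 and $\rho_E(f)e_y=\sum_{k=1}^N f(\gamma_k(y),y)\,e_{\gamma_k(y)}$. For $n\in\mathbb Z$ let $\upsilon_n$ be the unitary on $\ell^2(\mathbb Z)$ with $\upsilon_ne_k=e_{n+k}$; these generate $C^*(\mathbb Z)$. Put $\hat\rho_A(a)=\rho_A(a)\otimes\upsilon_0$ and $\hat\rho_E(f)=\rho_E(f)\otimes\upsilon_1$, and let $C^*(\hat\rho)$ be the C*-subalgebra of $M_{\mathbb X}\otimes C^*(\mathbb Z)$ generated by $\hat\rho_A(A)\cup\hat\rho_E(E)$. For $x\in X$ and a word $\boldsymbol k=(k_n,\dots,k_1)$ in $\{1,\dots,N\}$ put $\gamma_{\boldsymbol k}=\gamma_{k_n}\circ\cdots\circ\gamma_{k_1}$ and $\boldsymbol\gamma_{\boldsymbol k}(x)=(\gamma_{k_n,\dots,k_1}(x),\dots,\gamma_{k_1}(x),x)$. Let $X_{m,n}$ be the compact space of all pairs $(\boldsymbol\gamma_{\boldsymbol j}(x),\boldsymbol\gamma_{\boldsymbol k}(x))$ with $x\in X$ and $\boldsymbol j$, $\boldsymbol k$ words of lengths $m$ and $n$, and define $\rho_{m,n}\colon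 C(X_{m,n})\to M_{\mathbb X}$ by $$\rho_{m,n}(f)\,e_{\gamma_{\boldsymbol k}(x)}=\sum_{\boldsymbol j\in\{1,\dots,N\}^m} f(\boldsymbol\gamma_{\boldsymbol j}(x),\boldsymbol\gamma_{\boldsymbol k}(x))\,e_{\gamma_{\boldsymbol j}(x)}\qquad(x\in\mathbb X,\ \boldsymbol k\in\{1,\dots,N\}^n),$$ and $\rho_{m,n}(f)e_y=0$ if $y\in\mathbb X$ is not of the form $\gamma_{\boldsymbol k}(x)$ with $x\in\mathbb X$ and $\boldsymbol k$ of length $n$. For $k\in\mathbb Z$ let $B_k$ be the closed linear span of the ranges of the maps $\rho_{m,n}$ with $m-n=k$, and let $D_k$ be the set of all $\alpha\in B_k$ that are diagonal with respect to $(e_x)_{x\in\mathbb X}$. Finally let $\hat D=\bigoplus_{k\in\mathbb Z}D_k\otimes\upsilon_k$ (closed direct sum, that is, the closed linear span of the spaces $D_k\otimes\upsilon_k$). Then $\hat D$ is a maximal abelian subalgebra of $C^*(\hat\rho)$: it is a closed commutative $*$-subalgebra of $C^*(\hat\rho)$ that is not properly contained in any commutative $*$-subalgebra of $C^*(\hat\rho)$.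 Moreover, $\hat D$ contains $\hat\rho_A(A)$. -/

import Mathlib

open scoped TensorProduct

noncomputable section

namespace KW

/-! ### Square matrices indexed by a set -/

/-- The Hilbert space `ℓ²(S)`, the Hilbert space direct sum of copies of `ℂ` indexed by `S`. -/
abbrev HSpace (S : Type*) : Type _ := lp (fun _ : S => ℂ) 2

/-- The C*-algebra of all `S`-squared matrices, that is, of bounded operators on `ℓ²(S)`. -/
abbrev SqMatrix (S : Type*) : Type _ := HSpace S →L[ℂ] HSpace S

open scoped Classical in
/-- The standard basis vector `e_x` of `ℓ²(S)`. -/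
def basisVec {S : Type*} (x : S) : HSpace S := lp.single 2 x (1 : ℂ)

theorem basisVec_self {S : Type*} (x : S) : (basisVec x : S → ℂ) x = 1 := by
  simp [basisVec]

theorem basisVec_ne {S : Type*} {x y : S} (h : y ≠ x) : (basisVec x : S → ℂ) y = 0 := by
  simp [basisVec, h]

theorem inner_basisVec {S : Type*} (x : S) (v : HSpace S) : inner ℂ (basisVec x) v = v x := by
  simp [basisVec, lp.inner_single_left]

theorem norm_basisVec {S : Type*} (x : S) : ‖basisVec x‖ = 1 := by
  simp [basisVec, lp.norm_single]

/-- An operator on `ℓ²(S)` is diagonal when all its `(x, y)`-entries `⟪e_x, α e_y⟫` with `x ≠ y`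
vanish. These operators form a linear subspace. -/
def diagonal (S : Type*) : Submodule ℂ (SqMatrix S) where
  carrier := {α | ∀ x y : S, inner ℂ (basisVec x) (α (basisVec y)) ≠ 0 → x = y}
  add_mem' := by
    intro α β hα hβ x y h
    by_contra hxy
    apply h
    rw [add_apply, inner_add_right, not_not.1 (mt (hα x y) hxy),
      not_not.1 (mt (hβ x y) hxy), add_zero]
  zero_mem' := by
    intro x y h
    simp at h
  smul_mem' := by
    intro c α hα x y h
    by_contra hxy
    apply h
    rw [smul_apply, inner_smul_right, not_not.1 (mt (hα x y) hxy), mul_zero]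

theorem orthogonalFamily_push {S T : Type*} {φ : S → T} (hφ : Function.Injective φ) :
    OrthogonalFamily ℂ (fun _ : S => ℂ)
      (fun x => LinearIsometry.toSpanSingleton ℂ (HSpace T) (norm_basisVec (φ x))) := by
  intro x y hxy a b
  simp only [LinearIsometry.toSpanSingleton_apply, inner_smul_left, inner_smul_right,
    inner_basisVec]
  rw [basisVec_ne (fun h => hxy (hφ h))]
  simp

/-- The isometry `ℓ²(S) → ℓ²(T)` with `e_x ↦ e_{φ x}` attached to an injective map `φ`. -/
def push {S T : Type*} (φ : S → T) (hφ : Function.Injective φ) : HSpace S →L[ℂ] HSpace T :=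
  (orthogonalFamily_push hφ).linearIsometry.toContinuousLinearMap

theorem push_basisVec {S T : Type*} (φ : S → T) (hφ : Function.Injective φ) (x : S) :
    push φ hφ (basisVec x) = basisVec (φ x) := by
  classical
  have h := (orthogonalFamily_push hφ).linearIsometry_apply_single (i := x) (1 : ℂ)
  have h2 : (basisVec x : HSpace S) = lp.single 2 x (1 : ℂ) := by
    unfold basisVec
    congr
  rw [push, LinearIsometry.coe_toContinuousLinearMap, h2, h]
  simp

/-- The unitary `υ_n` on `ℓ²(ℤ)` with `υ_n e_k = e_{n+k}`; these generate `C*(ℤ)`. -/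
def upsilon (n : ℤ) : SqMatrix ℤ := push (fun k : ℤ => n + k) (add_right_injective n)

/-! ### Tensor products of Hilbert spaces and of operators -/

section HilbertTensor
variable (H K : Type*) [NormedAddCommGroup H] [InnerProductSpace ℂ H]
    [NormedAddCommGroup K] [InnerProductSpace ℂ K]

/-- The Hilbert space tensor product: the completion of the algebraic one. -/
def HTensor : Type _ := UniformSpace.Completion (H ⊗[ℂ] K)

instance : NormedAddCommGroup (HTensor H K) :=
  inferInstanceAs (NormedAddCommGroup (UniformSpace.Completion (H ⊗[ℂ] K)))

instance : InnerProductSpace ℂ (HTensor H K) :=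
  inferInstanceAs (InnerProductSpace ℂ (UniformSpace.Completion (H ⊗[ℂ] K)))

instance : CompleteSpace (HTensor H K) :=
  inferInstanceAs (CompleteSpace (UniformSpace.Completion (H ⊗[ℂ] K)))

variable {H K}

/-- The elementary tensor `v ⊗ w` in the Hilbert space tensor product. -/
def HTensor.tmul (v : H) (w : K) : HTensor H K :=
  UniformSpace.Completion.coe' (v ⊗ₜ[ℂ] w)

theorem HTensor.inner_tmul (v v' : H) (w w' : K) :
    inner ℂ (HTensor.tmul v w) (HTensor.tmul v' w') = inner ℂ v v' * inner ℂ w w' :=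
  (UniformSpace.Completion.inner_coe (𝕜 := ℂ) (v ⊗ₜ[ℂ] w) (v' ⊗ₜ[ℂ] w')).trans
    (TensorProduct.inner_tmul ℂ v v' w w')

theorem HTensor.dense_span_tmul :
    Dense (Submodule.span ℂ {t : HTensor H K | ∃ v w, t = HTensor.tmul v w} :
      Set (HTensor H K)) := by
  have h := UniformSpace.Completion.denseRange_coe (α := H ⊗[ℂ] K)
  refine Dense.mono ?_ h
  rintro _ ⟨t, rfl⟩
  induction t using TensorProduct.induction_on with
  | zero => exact Submodule.zero_mem _
  | tmul v w => exact Submodule.subset_span ⟨v, w, rfl⟩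
  | add s t hs ht =>
    rw [UniformSpace.Completion.coe_add]
    exact Submodule.add_mem _ hs ht

/-- The operator `α ⊗ β` on the Hilbert space tensor product, with
`(α ⊗ β) (v ⊗ w) = α v ⊗ β w`. -/
def opTensor (α : H →L[ℂ] H) (β : K →L[ℂ] K) : HTensor H K →L[ℂ] HTensor H K :=
  (TensorProduct.mapL α β).completion

theorem opTensor_tmul (α : H →L[ℂ] H) (β : K →L[ℂ] K) (v : H) (w : K) :
    opTensor α β (HTensor.tmul v w) = HTensor.tmul (α v) (β w) :=
  UniformSpace.Completion.map_coe (TensorProduct.mapL α β).uniformContinuous (v ⊗ₜ[ℂ] w)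

end HilbertTensor

/-- The C*-algebra of bounded operators on `ℓ²(S) ⊗ ℓ²(ℤ)`. It contains the (spatial) C*-tensor
product of the `S`-squared matrices with `C*(ℤ)` as a C*-subalgebra. -/
abbrev BigAlg (S : Type*) : Type _ :=
  HTensor (HSpace S) (HSpace ℤ) →L[ℂ] HTensor (HSpace S) (HSpace ℤ)

/-! ### Iterated function systems, chains and bichains -/

section Systems

variable {X : Type*} [TopologicalSpace X] {N : ℕ}

/-- Conditions on an iterated function system `γ` and a subset `S` of the space: `S` is dense and
completely invariant, the images `γ_k(S)` are pairwise disjoint and each `γ_k` is injective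
on `S`. -/
structure IsRegularSubset (γ : Fin N → C(X, X)) (S : Set X) : Prop where
  dense : Dense S
  image_subset : ∀ k, γ k '' S ⊆ S
  preimage_subset : ∀ k, γ k ⁻¹' S ⊆ S
  disjoint : ∀ j k, j ≠ k → Disjoint (γ j '' S) (γ k '' S)
  injOn : ∀ k, Set.InjOn (γ k) S

/-- The open set condition for `γ` as witnessed by the set `U`. -/
structure OpenSetCondition (γ : Fin N → C(X, X)) (U : Set X) : Prop where
  isOpen : IsOpen U
  dense : Dense U
  disjoint : ∀ j k, j ≠ k → Disjoint (γ j '' U) (γ k '' U)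
  isOpen_image : ∀ k, IsOpen (γ k '' U)
  image_subset : ∀ k, γ k '' U ⊆ U

/-- The graph `G = ⋃ₖ {(x, y) | x = γ_k(y)}`. -/
def graph (γ : Fin N → C(X, X)) : Set (X × X) := {p | ∃ k, p.1 = γ k p.2}

/-- The space of `γ`-chains of length `n`: tuples `(c 0, …, c n)` in which every `c (i + 1)` is
the image of `c i` under some `γ_k`. -/
def chains (γ : Fin N → C(X, X)) (n : ℕ) : Set (Fin (n + 1) → X) :=
  {c | ∀ i : Fin n, ∃ k, c i.succ = γ k (c i.castSucc)}

/-- The space of `γ`-bichains of length `(m, n)`: pairs of chains of lengths `m` and `n` with the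
same starting point. -/
def bichains (γ : Fin N → C(X, X)) (m n : ℕ) : Set ((Fin (m + 1) → X) × (Fin (n + 1) → X)) :=
  {p | p.1 ∈ chains γ m ∧ p.2 ∈ chains γ n ∧ p.1 0 = p.2 0}

/-- For an index word `w = (w 0, …, w (n-1))`, the points `x`, `γ_{w 0}(x)`,
`γ_{w 1}(γ_{w 0}(x))`, …; as an `(n+1)`-tuple this is the chain of `x` along `w`. -/
def orbit (γ : Fin N → C(X, X)) {n : ℕ} (w : Fin n → Fin N) (x : X) (i : Fin (n + 1)) : X :=
  Fin.induction (motive := fun _ => X) x (fun j y => γ (w j) y) i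

/-- The composition `γ_w = γ_{w (n-1)} ∘ ⋯ ∘ γ_{w 0}`. -/
def wordMap (γ : Fin N → C(X, X)) {n : ℕ} (w : Fin n → Fin N) (x : X) : X :=
  orbit γ w x (Fin.last n)

theorem orbit_zero (γ : Fin N → C(X, X)) {n : ℕ} (w : Fin n → Fin N) (x : X) :
    orbit γ w x 0 = x := rfl

theorem orbit_succ (γ : Fin N → C(X, X)) {n : ℕ} (w : Fin n → Fin N) (x : X) (i : Fin n) :
    orbit γ w x i.succ = γ (w i) (orbit γ w x i.castSucc) := by
  simp [orbit]

theorem orbit_mem_chains (γ : Fin N → C(X, X)) {n : ℕ} (w : Fin n → Fin N) (x : X) :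
    orbit γ w x ∈ chains γ n := fun i => ⟨w i, orbit_succ γ w x i⟩

theorem continuous_orbit (γ : Fin N → C(X, X)) {n : ℕ} (w : Fin n → Fin N) :
    Continuous (fun x => orbit γ w x) := by
  refine continuous_pi fun i => ?_
  induction i using Fin.induction with
  | zero => exact continuous_id
  | succ i ih =>
    simp only [orbit_succ]
    exact (γ (w i)).continuous.comp ih

/-- The continuous map sending `x` to the bichain of `x` along the pair of words `(v, w)`. -/
def bichainMap (γ : Fin N → C(X, X)) {m n : ℕ} (v : Fin m → Fin N) (w : Fin n → Fin N) :
    C(X, bichains γ m n) where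
  toFun x := ⟨(orbit γ v x, orbit γ w x), orbit_mem_chains γ v x, orbit_mem_chains γ w x, rfl⟩
  continuous_toFun :=
    ((continuous_orbit γ v).prodMk (continuous_orbit γ w)).subtype_mk _

/-- The continuous map `y ↦ (γ_k(y), y)` into the graph. -/
def graphMap (γ : Fin N → C(X, X)) (k : Fin N) : C(X, graph γ) where
  toFun y := ⟨(γ k y, y), k, rfl⟩
  continuous_toFun := ((γ k).continuous.prodMk continuous_id).subtype_mk _

theorem orbit_mem {γ : Fin N → C(X, X)} {S : Set X} (hS : IsRegularSubset γ S) {n : ℕ}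
    (w : Fin n → Fin N) {x : X} (hx : x ∈ S) (i : Fin (n + 1)) : orbit γ w x i ∈ S := by
  induction i using Fin.induction with
  | zero => exact hx
  | succ i ih => exact orbit_succ γ w x i ▸ hS.image_subset _ (Set.mem_image_of_mem _ ih)

theorem orbit_unique {γ : Fin N → C(X, X)} {S : Set X} (hS : IsRegularSubset γ S) {n : ℕ}
    {v w : Fin n → Fin N} {x y : X} (hx : x ∈ S) (hy : y ∈ S)
    (h : wordMap γ v x = wordMap γ w y) : v = w ∧ x = y := by
  have step : ∀ i : Fin n, orbit γ v x i.succ = orbit γ w y i.succ →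
      v i = w i ∧ orbit γ v x i.castSucc = orbit γ w y i.castSucc := by
    intro i hi
    rw [orbit_succ, orbit_succ] at hi
    have hvw : v i = w i := by
      by_contra hne
      exact Set.disjoint_left.1 (hS.disjoint _ _ hne)
        (Set.mem_image_of_mem _ (orbit_mem hS v hx i.castSucc))
        (hi ▸ Set.mem_image_of_mem _ (orbit_mem hS w hy i.castSucc))
    rw [← hvw] at hi
    exact ⟨hvw, hS.injOn _ (orbit_mem hS v hx _) (orbit_mem hS w hy _) hi⟩
  have all : ∀ i : Fin (n + 1), orbit γ v x i = orbit γ w y i := by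
    intro i
    induction i using Fin.reverseInduction with
    | last => exact h
    | cast i ih => exact (step i ih).2
  exact ⟨funext fun i => (step i (all _)).1, all 0⟩

/-- The map `γ_w` as a self-map of `S`. -/
def wordMapOn {γ : Fin N → C(X, X)} {S : Set X} (hS : IsRegularSubset γ S) {n : ℕ}
    (w : Fin n → Fin N) (x : S) : S := ⟨wordMap γ w x, orbit_mem hS w x.2 _⟩

theorem wordMapOn_injective {γ : Fin N → C(X, X)} {S : Set X} (hS : IsRegularSubset γ S)
    {n : ℕ} (w : Fin n → Fin N) : Function.Injective (wordMapOn hS w) := fun x y h =>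
  Subtype.ext (orbit_unique hS x.2 y.2 (congrArg Subtype.val h)).2

/-- The map `γ_k` as a self-map of `S`. -/
def mapOn {γ : Fin N → C(X, X)} {S : Set X} (hS : IsRegularSubset γ S) (k : Fin N) (x : S) : S :=
  ⟨γ k x, hS.image_subset k (Set.mem_image_of_mem _ x.2)⟩

theorem mapOn_injective {γ : Fin N → C(X, X)} {S : Set X} (hS : IsRegularSubset γ S)
    (k : Fin N) : Function.Injective (mapOn hS k) := fun x y h =>
  Subtype.ext (hS.injOn k x.2 y.2 (congrArg Subtype.val h))

end Systems

/-! ### The representation and the associated algebras -/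

section Representation

variable {X : Type*} [TopologicalSpace X] [CompactSpace X] {N : ℕ}

theorem norm_mul_apply_le {S : Set X} (a : C(X, ℂ)) (v : HSpace S) (x : S) :
    ‖a x * v x‖ ≤ ‖((‖a‖ : ℂ) • v : HSpace S) x‖ := by
  simp only [lp.coeFn_smul, Pi.smul_apply, smul_eq_mul, norm_mul, Complex.norm_real, norm_norm]
  gcongr
  exact a.norm_coe_le_norm x

/-- Pointwise multiplication of a vector of `ℓ²(S)` by a continuous function. -/
def mulVec {S : Set X} (a : C(X, ℂ)) (v : HSpace S) : HSpace S :=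
  ⟨fun x => a x * v x, (lp.memℓp ((‖a‖ : ℂ) • v)).mono' (norm_mul_apply_le a v)⟩

theorem mulVec_apply {S : Set X} (a : C(X, ℂ)) (v : HSpace S) (x : S) :
    mulVec a v x = a x * v x := rfl

theorem norm_mulVec_le {S : Set X} (a : C(X, ℂ)) (v : HSpace S) : ‖mulVec a v‖ ≤ ‖a‖ * ‖v‖ := by
  have h : ‖mulVec a v‖ ≤ ‖((‖a‖ : ℂ) • v : HSpace S)‖ :=
    lp.norm_mono (by norm_num) (norm_mul_apply_le a v)
  rwa [norm_smul, Complex.norm_real, norm_norm] at h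

/-- The bounded operator of multiplication by a continuous function. -/
def mulOp (S : Set X) (a : C(X, ℂ)) : SqMatrix S :=
  LinearMap.mkContinuous
    { toFun := mulVec a
      map_add' := fun v w => lp.ext <| funext fun x => mul_add (a x) (v x) (w x)
      map_smul' := fun c v => lp.ext <| funext fun x => mul_left_comm (a x) c (v x) }
    ‖a‖ (norm_mulVec_le a)

/-- The representation `ρ_A` of `A = C(X)` on `ℓ²(S)` by multiplication operators,
`ρ_A(a) e_x = a(x) e_x`. -/
def rhoA (S : Set X) : C(X, ℂ) →ₗ[ℂ] SqMatrix S where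
  toFun := mulOp S
  map_add' a b := ContinuousLinearMap.ext fun v => lp.ext <| funext fun x =>
    add_mul (a x) (b x) (v x)
  map_smul' c a := ContinuousLinearMap.ext fun v => lp.ext <| funext fun x =>
    mul_assoc c (a x) (v x)

theorem rhoA_apply (S : Set X) (a : C(X, ℂ)) (v : HSpace S) (x : S) :
    rhoA S a v x = a x * v x := rfl

theorem rhoA_basisVec (S : Set X) (a : C(X, ℂ)) (x : S) :
    rhoA S a (basisVec x) = a x • basisVec x := by
  ext y
  rw [rhoA_apply, lp.coeFn_smul, Pi.smul_apply, smul_eq_mul]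
  by_cases h : y = x
  · rw [h]
  · rw [basisVec_ne h, mul_zero, mul_zero]

variable {γ : Fin N → C(X, X)} {S : Set X}

/-- The map `ρ_E` on `E = C(G)`, with `ρ_E(f) e_y = ∑ₖ f(γ_k(y), y) e_{γ_k(y)}`. -/
def rhoE (hS : IsRegularSubset γ S) (f : C(graph γ, ℂ)) : SqMatrix S :=
  ∑ k, push (mapOn hS k) (mapOn_injective hS k) ∘L rhoA S (f.comp (graphMap γ k))

theorem rhoE_basisVec (hS : IsRegularSubset γ S) (f : C(graph γ, ℂ)) (y : S) :
    rhoE hS f (basisVec y) = ∑ k, f ⟨(γ k y, y), k, rfl⟩ • basisVec (mapOn hS k y) := by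
  simp [rhoE, rhoA_basisVec, push_basisVec, graphMap]

/-- The map `ρ_{m,n}` on the continuous functions on the space of bichains. The theorems
`rhoBi_basisVec` and `rhoBi_basisVec_eq_zero` give the entries of its values. -/
def rhoBi (hS : IsRegularSubset γ S) (m n : ℕ) : C(bichains γ m n, ℂ) →ₗ[ℂ] SqMatrix S where
  toFun f := ∑ v : Fin m → Fin N, ∑ w : Fin n → Fin N,
    push (wordMapOn hS v) (wordMapOn_injective hS v) ∘L rhoA S (f.comp (bichainMap γ v w)) ∘L
      ContinuousLinearMap.adjoint (push (wordMapOn hS w) (wordMapOn_injective hS w))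
  map_add' f g := by
    simp only [← Finset.sum_add_distrib]
    refine Finset.sum_congr rfl fun v _ => Finset.sum_congr rfl fun w _ => ?_
    have : (f + g).comp (bichainMap γ v w) = f.comp (bichainMap γ v w) + g.comp (bichainMap γ v w) :=
      rfl
    rw [this, map_add, ContinuousLinearMap.add_comp, ContinuousLinearMap.comp_add]
  map_smul' c f := by
    simp only [Finset.smul_sum, RingHom.id_apply]
    refine Finset.sum_congr rfl fun v _ => Finset.sum_congr rfl fun w _ => ?_
    have : (c • f).comp (bichainMap γ v w) = c • f.comp (bichainMap γ v w) := rfl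
    rw [this, map_smul, ContinuousLinearMap.smul_comp, ContinuousLinearMap.comp_smul]

theorem adjoint_push_basisVec_of_notMem {S T : Type*} (φ : S → T) (hφ : Function.Injective φ)
    (y : T) (hy : ∀ x, φ x ≠ y) : ContinuousLinearMap.adjoint (push φ hφ) (basisVec y) = 0 := by
  ext x
  rw [← inner_basisVec, ContinuousLinearMap.adjoint_inner_right, push_basisVec, inner_basisVec,
    basisVec_ne (hy x)]
  rfl

theorem adjoint_push_basisVec {S T : Type*} (φ : S → T) (hφ : Function.Injective φ)
    (x : S) : ContinuousLinearMap.adjoint (push φ hφ) (basisVec (φ x)) = basisVec x := by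
  ext z
  rw [← inner_basisVec, ContinuousLinearMap.adjoint_inner_right, push_basisVec, inner_basisVec]
  by_cases h : z = x
  · rw [h, basisVec_self, basisVec_self]
  · rw [basisVec_ne h, basisVec_ne (fun h' => h (hφ h'))]

theorem rhoBi_basisVec (hS : IsRegularSubset γ S) {m n : ℕ} (f : C(bichains γ m n, ℂ))
    (w : Fin n → Fin N) (x : S) :
    rhoBi hS m n f (basisVec (wordMapOn hS w x))
      = ∑ v : Fin m → Fin N, f (bichainMap γ v w x) • basisVec (wordMapOn hS v x) := by
  simp only [rhoBi, LinearMap.coe_mk, AddHom.coe_mk, sum_apply,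
    ContinuousLinearMap.comp_apply]
  refine Finset.sum_congr rfl fun v _ => ?_
  rw [Finset.sum_eq_single w]
  · rw [adjoint_push_basisVec, rhoA_basisVec, map_smul, push_basisVec]
    rfl
  · intro u _ hu
    rw [adjoint_push_basisVec_of_notMem, map_zero, map_zero]
    intro z hz
    exact hu (orbit_unique hS z.2 x.2 (congrArg Subtype.val hz)).1
  · simp

theorem rhoBi_basisVec_eq_zero (hS : IsRegularSubset γ S) {m n : ℕ} (f : C(bichains γ m n, ℂ))
    (y : S) (hy : ∀ (w : Fin n → Fin N) (x : S), wordMapOn hS w x ≠ y) :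
    rhoBi hS m n f (basisVec y) = 0 := by
  simp only [rhoBi, LinearMap.coe_mk, AddHom.coe_mk, sum_apply,
    ContinuousLinearMap.comp_apply]
  refine Finset.sum_eq_zero fun v _ => Finset.sum_eq_zero fun w _ => ?_
  rw [adjoint_push_basisVec_of_notMem _ _ _ (hy w), map_zero, map_zero]

/-- The space `E_{m,n}`, the range of `ρ_{m,n}`. -/
def Espace (hS : IsRegularSubset γ S) (m n : ℕ) : Submodule ℂ (SqMatrix S) :=
  LinearMap.range (rhoBi hS m n)

/-- The space `B_k`, the closed linear span of the `E_{m,n}` with `m - n = k`. -/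
def Bspace (hS : IsRegularSubset γ S) (k : ℤ) : Submodule ℂ (SqMatrix S) :=
  (⨆ (m : ℕ) (n : ℕ) (_ : (m : ℤ) - (n : ℤ) = k), Espace hS m n).topologicalClosure

/-- The space `D_k` of diagonal matrices in `B_k`. -/
def Dspace (hS : IsRegularSubset γ S) (k : ℤ) : Submodule ℂ (SqMatrix S) :=
  Bspace hS k ⊓ diagonal S

/-- `ρ̂_A(a) = ρ_A(a) ⊗ υ_0`. -/
def rhoHatA (S : Set X) (a : C(X, ℂ)) : BigAlg S := opTensor (rhoA S a) (upsilon 0)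

/-- `ρ̂_E(f) = ρ_E(f) ⊗ υ_1`. -/
def rhoHatE (hS : IsRegularSubset γ S) (f : C(graph γ, ℂ)) : BigAlg S :=
  opTensor (rhoE hS f) (upsilon 1)

/-- The C*-algebra `C*(ρ̂)` generated by the ranges of `ρ̂_A` and `ρ̂_E`. -/
def cstarHat (hS : IsRegularSubset γ S) : NonUnitalStarSubalgebra ℂ (BigAlg S) :=
  (NonUnitalStarAlgebra.adjoin ℂ
    (Set.range (rhoHatA S) ∪ Set.range (rhoHatE hS))).topologicalClosure

/-- The space `D̂ = ⨁ₖ D_k ⊗ υ_k`, where the direct sum is the closed one: the closed linear span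
of the spaces `D_k ⊗ υ_k` for `k ∈ ℤ`. -/
def Dhat (hS : IsRegularSubset γ S) : Submodule ℂ (BigAlg S) :=
  (Submodule.span ℂ
    {T : BigAlg S | ∃ k : ℤ, ∃ α ∈ Dspace hS k, T = opTensor α (upsilon k)}).topologicalClosure

end Representation

/-- `D` is a maximal abelian subalgebra (masa) of `C`: it is a norm-closed `*`-subalgebra which is
maximal among all commutative `*`-subalgebras contained in `C`. -/
structure IsMasa {B : Type*} [NonUnitalSemiring B] [StarRing B] [Module ℂ B] [TopologicalSpace B]
    (D C : NonUnitalStarSubalgebra ℂ B) : Prop where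
  isClosed : IsClosed (D : Set B)
  maximal : Maximal (fun T : NonUnitalStarSubalgebra ℂ B =>
    T ≤ C ∧ ∀ x ∈ T, ∀ y ∈ T, x * y = y * x) D

end KW

end

/-!
Write `T = ρ_E(1)` for the operator with `T e_y = ∑ₖ e_{γ_k(y)}`. The images `γ_k(S)` being
disjoint, `T* ρ_A(a) T = ρ_A(∑ₖ a ∘ γ_k)` (`star_gen_mul_rhoA_mul_gen`). Hence every product of
operators `ρ_A(a)`, `T`, `T*` reduces to a monomial `α β*` with `α`, `β` words of the form
`ρ_A(p_m) T ρ_A(p_{m-1}) T ⋯ T ρ_A(p_0)` (`IsWord.cancel`, `mul_mem_monomials`). Such a monomial is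
`ρ_{m,n}(f)` for a product function `f` on the space of bichains, and the product functions are
total by the Stone–Weierstrass theorem, so `B_k` is the closed linear span of the monomials of
degree `k` (`Bspace_eq`). Consequently `B_k B_l ⊆ B_{k+l}` and `B_k* ⊆ B_{-k}`; the closed direct
sum `⨁ₖ B_k ⊗ υ_k` is a `*`-algebra containing the generators of `C*(ρ̂)`
(`mem_of_mem_cstarHat`), and each `B_k ⊗ υ_k` lies in `C*(ρ̂)` (`opTensor_mem_cstarHat`).

The spaces `D_k` inherit these relations and diagonal matrices commute, so `D̂` is a commutative
closed `*`-subalgebra of `C*(ρ̂)`, and it contains `ρ̂_A(A)`. For maximality it suffices that any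
`Q ∈ C*(ρ̂)` commuting with `ρ̂_A(A)` lies in `D̂` (`mem_Dhat_of_commute`). Its Fourier coefficients
`Φ_k(Q)` (`fourierCoef`) lie in `B_k` and commute with `ρ_A(A)`. As `C(X)` separates the points of
`X`, they are diagonal, that is, they lie in `D_k`. Finally `Q` is the norm limit of its Fejér
means, which are combinations of the operators `Φ_k(Q) ⊗ υ_k ∈ D_k ⊗ υ_k` (`tendsto_fejer`). The
means are contractive since on finite sums they average the gauge action against the positive
Fejér kernel, sampled at sufficiently many roots of unity (`norm_fejer_le`).
-/

noncomputable section

namespace KW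

/-! ### Operators on Hilbert space tensor products -/

section HilbertTensorLemmas
variable {H K : Type*} [NormedAddCommGroup H] [InnerProductSpace ℂ H]
    [NormedAddCommGroup K] [InnerProductSpace ℂ K]

theorem HTensor.add_tmul (v v' : H) (w : K) :
    HTensor.tmul (v + v') w = HTensor.tmul v w + HTensor.tmul v' w := by
  unfold HTensor.tmul
  rw [TensorProduct.add_tmul]
  exact UniformSpace.Completion.coe_add _ _

theorem HTensor.smul_tmul (c : ℂ) (v : H) (w : K) :
    HTensor.tmul (c • v) w = c • HTensor.tmul v w := by
  unfold HTensor.tmul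
  rw [← TensorProduct.smul_tmul']
  exact UniformSpace.Completion.coe_smul _ _

theorem HTensor.tmul_smul (c : ℂ) (v : H) (w : K) :
    HTensor.tmul v (c • w) = c • HTensor.tmul v w := by
  unfold HTensor.tmul
  rw [TensorProduct.tmul_smul]
  exact UniformSpace.Completion.coe_smul _ _

theorem HTensor.norm_tmul (v : H) (w : K) : ‖HTensor.tmul v w‖ = ‖v‖ * ‖w‖ :=
  (UniformSpace.Completion.norm_coe (v ⊗ₜ[ℂ] w)).trans (TensorProduct.norm_tmul v w)

theorem HTensor.clm_ext {F : Type*} [NormedAddCommGroup F] [NormedSpace ℂ F]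
    {P Q : HTensor H K →L[ℂ] F}
    (h : ∀ v w, P (HTensor.tmul v w) = Q (HTensor.tmul v w)) : P = Q := by
  refine ContinuousLinearMap.ext_on HTensor.dense_span_tmul ?_
  rintro _ ⟨v, w, rfl⟩
  exact h v w

theorem opTensor_mul (α α' : H →L[ℂ] H) (β β' : K →L[ℂ] K) :
    opTensor α β * opTensor α' β' = opTensor (α * α') (β * β') :=
  HTensor.clm_ext fun v w => by
    simp only [mul_apply_eq_comp, opTensor_tmul]

theorem opTensor_add (α α' : H →L[ℂ] H) (β : K →L[ℂ] K) :
    opTensor (α + α') β = opTensor α β + opTensor α' β :=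
  HTensor.clm_ext fun v w => by
    simp only [add_apply, opTensor_tmul, HTensor.add_tmul]

theorem opTensor_smul (c : ℂ) (α : H →L[ℂ] H) (β : K →L[ℂ] K) :
    opTensor (c • α) β = c • opTensor α β :=
  HTensor.clm_ext fun v w => by
    simp only [smul_apply, opTensor_tmul, HTensor.smul_tmul]

theorem opTensor_smul_right (c : ℂ) (α : H →L[ℂ] H) (β : K →L[ℂ] K) :
    opTensor α (c • β) = c • opTensor α β :=
  HTensor.clm_ext fun v w => by
    simp only [smul_apply, opTensor_tmul, HTensor.tmul_smul]

theorem norm_opTensor_le (α : H →L[ℂ] H) (β : K →L[ℂ] K) :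
    ‖opTensor α β‖ ≤ ‖α‖ * ‖β‖ := by
  refine ContinuousLinearMap.opNorm_le_bound _ (by positivity) fun x => ?_
  -- `HTensor H K` is by definition the completion of `H ⊗[ℂ] K`, where the bound is known.
  refine UniformSpace.Completion.induction_on (α := H ⊗[ℂ] K)
    (p := fun x : UniformSpace.Completion (H ⊗[ℂ] K) =>
      ‖(TensorProduct.mapL α β).completion x‖ ≤ ‖α‖ * ‖β‖ * ‖x‖) x ?_ fun t => ?_
  · exact isClosed_le (ContinuousLinearMap.continuous _).norm (by fun_prop)
  · rw [ContinuousLinearMap.completion_apply_coe, UniformSpace.Completion.norm_coe,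
      UniformSpace.Completion.norm_coe]
    exact (ContinuousLinearMap.le_opNorm _ _).trans
      (mul_le_mul_of_nonneg_right (TensorProduct.norm_mapL_le α β) (norm_nonneg _))

variable (H) in
/-- The operator `α ↦ α ⊗ β` as a continuous linear map. -/
def opTensorL (β : K →L[ℂ] K) :
    (H →L[ℂ] H) →L[ℂ] (HTensor H K →L[ℂ] HTensor H K) :=
  LinearMap.mkContinuous
    { toFun := fun α => opTensor α β
      map_add' := fun α α' => opTensor_add α α' β
      map_smul' := fun c α => opTensor_smul c α β } ‖β‖
    fun α => (norm_opTensor_le α β).trans_eq (mul_comm _ _)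

@[simp]
theorem opTensorL_apply (α : H →L[ℂ] H) (β : K →L[ℂ] K) : opTensorL H β α = opTensor α β := rfl

theorem star_opTensor [CompleteSpace H] [CompleteSpace K] (α : H →L[ℂ] H) (β : K →L[ℂ] K) :
    star (opTensor α β) = opTensor (star α) (star β) := by
  rw [ContinuousLinearMap.star_eq_adjoint]
  symm
  refine HTensor.clm_ext fun v w => ext_inner_right ℂ fun x => ?_
  rw [ContinuousLinearMap.adjoint_inner_left]
  -- Both sides of `⟪(α* ⊗ β*) (v ⊗ w), x⟫ = ⟪v ⊗ w, (α ⊗ β) x⟫` are bounded functionals of `x`, so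
  -- it is enough to compare them on elementary tensors.
  have : (innerSL ℂ (opTensor (star α) (star β) (HTensor.tmul v w)))
      = (innerSL ℂ (HTensor.tmul v w)).comp (opTensor α β) := by
    refine HTensor.clm_ext fun v' w' => ?_
    simp only [innerSL_apply_apply, ContinuousLinearMap.comp_apply, opTensor_tmul,
      HTensor.inner_tmul, ContinuousLinearMap.star_eq_adjoint,
      ContinuousLinearMap.adjoint_inner_left]
  simpa using congrArg (fun f => f x) this

variable (H) in
/-- The operator `v ↦ v ⊗ w`. -/
def tmulRight (w : K) : H →L[ℂ] HTensor H K :=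
  LinearMap.mkContinuous
    { toFun := fun v => HTensor.tmul v w
      map_add' := fun v v' => HTensor.add_tmul v v' w
      map_smul' := fun c v => HTensor.smul_tmul c v w } ‖w‖
    fun v => (HTensor.norm_tmul v w).le.trans_eq (mul_comm _ _)

@[simp]
theorem tmulRight_apply (v : H) (w : K) : tmulRight H w v = HTensor.tmul v w := rfl

theorem adjoint_tmulRight_tmul [CompleteSpace H] (w w' : K) (v : H) :
    ContinuousLinearMap.adjoint (tmulRight H w) (HTensor.tmul v w') = inner ℂ w w' • v := by
  refine ext_inner_left ℂ fun u => ?_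
  rw [ContinuousLinearMap.adjoint_inner_right, tmulRight_apply, HTensor.inner_tmul,
    inner_smul_right, mul_comm]

end HilbertTensorLemmas

/-! ### Diagonal matrices -/

section Matrices
variable {S : Type*}

theorem clm_ext_basisVec {F : Type*} [NormedAddCommGroup F] [NormedSpace ℂ F]
    {α β : HSpace S →L[ℂ] F} (h : ∀ x, α (basisVec x) = β (basisVec x)) : α = β := by
  classical
  refine lp.ext_continuousLinearMap (by norm_num) fun x => ?_
  refine ContinuousLinearMap.ext fun c => ?_
  have : lp.singleContinuousLinearMap ℂ (fun _ : S => ℂ) 2 x c = c • basisVec x := by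
    rw [lp.singleContinuousLinearMap_apply, basisVec, ← lp.single_smul, smul_eq_mul, mul_one]
  simp only [ContinuousLinearMap.comp_apply, this, map_smul, h]

theorem mem_diagonal_iff {α : SqMatrix S} :
    α ∈ diagonal S ↔ ∀ x y, x ≠ y → (α (basisVec y) : S → ℂ) x = 0 := by
  change (∀ x y, _ → _) ↔ _
  simp only [inner_basisVec]
  exact forall₂_congr fun x y => not_imp_comm

theorem apply_basisVec_of_mem_diagonal {α : SqMatrix S} (hα : α ∈ diagonal S) (y : S) :
    α (basisVec y) = (α (basisVec y) : S → ℂ) y • basisVec y := by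
  ext x
  rw [lp.coeFn_smul, Pi.smul_apply, smul_eq_mul]
  rcases eq_or_ne x y with rfl | h
  · rw [basisVec_self, mul_one]
  · rw [basisVec_ne h, mul_zero, mem_diagonal_iff.1 hα x y h]

theorem commute_of_mem_diagonal {α β : SqMatrix S} (hα : α ∈ diagonal S)
    (hβ : β ∈ diagonal S) : α * β = β * α :=
  clm_ext_basisVec fun y => by
    obtain ⟨a, ha⟩ : ∃ a : ℂ, α (basisVec y) = a • basisVec y :=
      ⟨_, apply_basisVec_of_mem_diagonal hα y⟩
    obtain ⟨b, hb⟩ : ∃ b : ℂ, β (basisVec y) = b • basisVec y :=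
      ⟨_, apply_basisVec_of_mem_diagonal hβ y⟩
    rw [mul_apply_eq_comp, mul_apply_eq_comp, ha, hb, map_smul, map_smul, ha, hb, smul_comm]

theorem mul_mem_diagonal {α β : SqMatrix S} (hα : α ∈ diagonal S)
    (hβ : β ∈ diagonal S) : α * β ∈ diagonal S :=
  mem_diagonal_iff.2 fun x y h => by
    rw [mul_apply_eq_comp, apply_basisVec_of_mem_diagonal hβ, map_smul,
      lp.coeFn_smul, Pi.smul_apply, mem_diagonal_iff.1 hα x y h, smul_zero]

theorem star_mem_diagonal {α : SqMatrix S} (hα : α ∈ diagonal S) : star α ∈ diagonal S :=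
  mem_diagonal_iff.2 fun x y h => by
    rw [← inner_basisVec, ContinuousLinearMap.star_eq_adjoint,
      ContinuousLinearMap.adjoint_inner_right, ← inner_conj_symm, inner_basisVec,
      mem_diagonal_iff.1 hα y x h.symm, map_zero]

end Matrices

/-! ### The shifts -/

section Upsilon

theorem upsilon_basisVec (n k : ℤ) : upsilon n (basisVec k) = basisVec (n + k) :=
  push_basisVec _ _ _

theorem upsilon_zero : upsilon 0 = 1 :=
  clm_ext_basisVec fun k => by rw [upsilon_basisVec, zero_add, one_apply_eq_self]

theorem upsilon_mul (m n : ℤ) : upsilon m * upsilon n = upsilon (m + n) :=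
  clm_ext_basisVec fun k => by
    rw [mul_apply_eq_comp, upsilon_basisVec, upsilon_basisVec, upsilon_basisVec,
      add_assoc]

theorem star_upsilon (n : ℤ) : star (upsilon n) = upsilon (-n) :=
  clm_ext_basisVec fun k => by
    have h := adjoint_push_basisVec (fun k : ℤ => n + k) (add_right_injective n) (-n + k)
    rw [show n + (-n + k) = k by ring] at h
    rw [upsilon_basisVec, ContinuousLinearMap.star_eq_adjoint]
    exact h

end Upsilon

/-! ### Multiplication operators -/

section RhoA

theorem exists_eq_zero_eq_one {X : Type*} [TopologicalSpace X] [CompactSpace X] [T2Space X]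
    {x y : X} (hxy : x ≠ y) : ∃ a : C(X, ℂ), a x = 0 ∧ a y = 1 := by
  obtain ⟨f, hfx, hfy, -⟩ := exists_continuous_zero_one_of_isClosed
    (isClosed_singleton (x := x)) (isClosed_singleton (x := y)) (Set.disjoint_singleton.2 hxy)
  refine ⟨⟨fun z => (f z : ℂ), Complex.continuous_ofReal.comp f.continuous⟩, ?_, ?_⟩
  · simpa using hfx rfl
  · simpa using hfy rfl

variable {X : Type*} [TopologicalSpace X] [CompactSpace X] (S : Set X)

theorem rhoA_mul (a b : C(X, ℂ)) : rhoA S (a * b) = rhoA S a * rhoA S b :=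
  ContinuousLinearMap.ext fun v => lp.ext <| funext fun x => mul_assoc (a x) (b x) (v x)

theorem rhoA_one : rhoA S 1 = 1 :=
  ContinuousLinearMap.ext fun v => lp.ext <| funext fun x => one_mul (v x)

theorem star_rhoA (a : C(X, ℂ)) : star (rhoA S a) = rhoA S (star a) :=
  clm_ext_basisVec fun y => lp.ext <| funext fun x => by
    rw [← inner_basisVec, ContinuousLinearMap.star_eq_adjoint,
      ContinuousLinearMap.adjoint_inner_right, rhoA_basisVec, rhoA_apply, inner_smul_left,
      inner_basisVec]
    rfl

theorem continuous_rhoA : Continuous (rhoA S) :=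
  (LinearMap.mkContinuous (rhoA S) 1 fun a => by
    rw [one_mul]
    exact LinearMap.mkContinuous_norm_le _ (norm_nonneg _) (norm_mulVec_le a)).continuous

theorem rhoA_mem_diagonal (a : C(X, ℂ)) : rhoA S a ∈ diagonal S :=
  mem_diagonal_iff.2 fun x y h => by
    rw [rhoA_apply, basisVec_ne h, mul_zero]

/-- Continuous functions separate the points of a compact Hausdorff space, so the commutant of
`ρ_A(A)` consists of diagonal matrices. -/
theorem mem_diagonal_of_commute [T2Space X] {α : SqMatrix S}
    (h : ∀ a, α * rhoA S a = rhoA S a * α) : α ∈ diagonal S :=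
  mem_diagonal_iff.2 fun x y hxy => by
    obtain ⟨a, hx, hy⟩ := exists_eq_zero_eq_one fun h => hxy (Subtype.ext h)
    have := congrArg (fun β : SqMatrix S => (β (basisVec y) : S → ℂ) x) (h a)
    simpa only [mul_apply_eq_comp, rhoA_basisVec, rhoA_apply, hx, hy, one_smul, zero_mul]
      using this

end RhoA

/-! ### Reduced words in the generators -/

section Words
variable {X : Type*} [TopologicalSpace X] [CompactSpace X] {N : ℕ}
variable {γ : Fin N → C(X, X)} {S : Set X} (hS : IsRegularSubset γ S)

/-- The generator `T = ρ_E(1)`, the operator with `T e_y = ∑ₖ e_{γ_k(y)}`. -/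
def gen : SqMatrix S := rhoE hS 1

theorem gen_eq_sum : gen hS = ∑ k, push (mapOn hS k) (mapOn_injective hS k) := by
  rw [gen, rhoE]
  refine Finset.sum_congr rfl fun k _ => ?_
  have : ((1 : C(graph γ, ℂ)).comp (graphMap γ k)) = 1 := rfl
  rw [this, rhoA_one]
  rfl

theorem gen_basisVec (y : S) : gen hS (basisVec y) = ∑ k, basisVec (mapOn hS k y) := by
  simp only [gen_eq_sum, sum_apply, push_basisVec]

theorem star_gen_basisVec (k : Fin N) (y : S) :
    star (gen hS) (basisVec (mapOn hS k y)) = basisVec y := by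
  rw [gen_eq_sum, star_sum, sum_apply, Finset.sum_eq_single k]
  · exact adjoint_push_basisVec _ _ _
  · intro j _ hj
    refine adjoint_push_basisVec_of_notMem _ _ _ fun x hx => ?_
    exact Set.disjoint_left.1 (hS.disjoint j k hj) ⟨x, x.2, rfl⟩
      ⟨y, y.2, (congrArg Subtype.val hx).symm⟩
  · simp

/-- The transfer operator `a ↦ ∑ₖ a ∘ γ_k` on `C(X)`. -/
def transfer (γ : Fin N → C(X, X)) (a : C(X, ℂ)) : C(X, ℂ) := ∑ k, a.comp (γ k)

/-- The disjointness of the sets `γ_k(S)` makes compression by `T` preserve `ρ_A(A)`. This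
relation is what brings every product of the generators into reduced form. -/
theorem star_gen_mul_rhoA_mul_gen (a : C(X, ℂ)) :
    star (gen hS) * (rhoA S a * gen hS) = rhoA S (transfer γ a) :=
  clm_ext_basisVec fun y => by
    simp only [mul_apply_eq_comp, gen_basisVec, map_sum, rhoA_basisVec, map_smul,
      star_gen_basisVec, transfer, ← Finset.sum_smul, sum_apply]
    rfl

/-- The reduced word `ρ_A(p_m) T ρ_A(p_{m-1}) T ⋯ T ρ_A(p_0)` with `m` factors `T`. -/
def wordOp (p : ℕ → C(X, ℂ)) : ℕ → SqMatrix S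
  | 0 => rhoA S (p 0)
  | m + 1 => rhoA S (p (m + 1)) * (gen hS * wordOp p m)

/-- The operators of the form `wordOp hS p m`. -/
def IsWord (m : ℕ) (α : SqMatrix S) : Prop := ∃ p, α = wordOp hS p m

variable {hS}

theorem wordOp_congr {p q : ℕ → C(X, ℂ)} : ∀ {m : ℕ}, (∀ i ≤ m, p i = q i) →
    wordOp hS p m = wordOp hS q m
  | 0, h => by rw [wordOp, wordOp, h 0 le_rfl]
  | m + 1, h => by
    rw [wordOp, wordOp, h _ le_rfl, wordOp_congr fun i hi => h i (hi.trans m.le_succ)]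

theorem isWord_zero_iff {α : SqMatrix S} : IsWord hS 0 α ↔ ∃ a, α = rhoA S a :=
  ⟨fun ⟨p, hp⟩ => ⟨p 0, hp⟩, fun ⟨a, ha⟩ => ⟨fun _ => a, ha⟩⟩

theorem isWord_succ_iff {m : ℕ} {α : SqMatrix S} :
    IsWord hS (m + 1) α ↔ ∃ a β, IsWord hS m β ∧ α = rhoA S a * (gen hS * β) := by
  refine ⟨fun ⟨p, hp⟩ => ⟨_, _, ⟨p, rfl⟩, hp⟩, ?_⟩
  rintro ⟨a, _, ⟨p, rfl⟩, rfl⟩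
  refine ⟨fun i => if i = m + 1 then a else p i, ?_⟩
  rw [wordOp, if_pos rfl, wordOp_congr (p := p)]
  intro i hi
  rw [if_neg (by omega)]

theorem IsWord.rhoA_mul {m : ℕ} {α : SqMatrix S} (hα : IsWord hS m α) (a : C(X, ℂ)) :
    IsWord hS m (rhoA S a * α) := by
  cases m with
  | zero =>
    obtain ⟨b, rfl⟩ := isWord_zero_iff.1 hα
    exact isWord_zero_iff.2 ⟨a * b, (KW.rhoA_mul S a b).symm⟩
  | succ m =>
    obtain ⟨b, β, hβ, rfl⟩ := isWord_succ_iff.1 hα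
    exact isWord_succ_iff.2 ⟨a * b, β, hβ, by rw [KW.rhoA_mul, mul_assoc]⟩

theorem IsWord.mul {m n : ℕ} {α β : SqMatrix S} (hα : IsWord hS m α) (hβ : IsWord hS n β) :
    IsWord hS (m + n) (α * β) := by
  induction m generalizing α with
  | zero =>
    obtain ⟨b, rfl⟩ := isWord_zero_iff.1 hα
    rw [zero_add]
    exact hβ.rhoA_mul b
  | succ m ih =>
    obtain ⟨b, α', hα', rfl⟩ := isWord_succ_iff.1 hα
    rw [Nat.succ_add_eq_add_succ]
    exact isWord_succ_iff.2 ⟨b, _, ih hα', by simp only [mul_assoc]⟩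

/-- Cancellation: `β* α` is a word when `β` and `α` are words of lengths `n` and `n + m`. -/
theorem IsWord.cancel {m n : ℕ} {α β : SqMatrix S} (hβ : IsWord hS n β)
    (hα : IsWord hS (n + m) α) : IsWord hS m (star β * α) := by
  induction n generalizing α β with
  | zero =>
    obtain ⟨b, rfl⟩ := isWord_zero_iff.1 hβ
    rw [zero_add] at hα
    rw [star_rhoA]
    exact hα.rhoA_mul _
  | succ n ih =>
    obtain ⟨b, β', hβ', rfl⟩ := isWord_succ_iff.1 hβ
    rw [Nat.succ_add_eq_add_succ] at hα
    obtain ⟨a, α', hα', rfl⟩ := isWord_succ_iff.1 hα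
    have : star (rhoA S b * (gen hS * β')) * (rhoA S a * (gen hS * α')) =
        star β' * (rhoA S (transfer γ (star b * a)) * α') := by
      rw [← star_gen_mul_rhoA_mul_gen hS, KW.rhoA_mul, ← star_rhoA]
      simp only [star_mul, mul_assoc]
    rw [this]
    exact ih hβ' (hα'.rhoA_mul _)

variable (hS) in
/-- The reduced monomials `α β*` of degree `k`, with `α` and `β` words whose lengths differ
by `k`. -/
def monomials (k : ℤ) : Set (SqMatrix S) :=
  {μ | ∃ m n α β, IsWord hS m α ∧ IsWord hS n β ∧ (m : ℤ) - n = k ∧ μ = α * star β}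

theorem star_mem_monomials {k : ℤ} {μ : SqMatrix S} (hμ : μ ∈ monomials hS k) :
    star μ ∈ monomials hS (-k) := by
  obtain ⟨m, n, α, β, hα, hβ, hk, rfl⟩ := hμ
  exact ⟨n, m, β, α, hβ, hα, by omega, by rw [star_mul, star_star]⟩

theorem mul_mem_monomials {k l : ℤ} {μ ν : SqMatrix S} (hμ : μ ∈ monomials hS k)
    (hν : ν ∈ monomials hS l) : μ * ν ∈ monomials hS (k + l) := by
  obtain ⟨m, n, α, β, hα, hβ, hk, rfl⟩ := hμ
  obtain ⟨m', n', α', β', hα', hβ', hl, rfl⟩ := hν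
  -- In `α (β* α') β'*` the inner factor is a word if `β` is shorter than `α'`, and the adjoint of
  -- a word otherwise; it is absorbed into the left or the right factor.
  rcases le_total n m' with h | h
  · obtain ⟨d, rfl⟩ := Nat.exists_eq_add_of_le h
    exact ⟨m + d, n', _, β', hα.mul (hβ.cancel hα'), hβ', by push_cast at *; omega,
      by simp only [mul_assoc]⟩
  · obtain ⟨d, rfl⟩ := Nat.exists_eq_add_of_le h
    exact ⟨m, n' + d, α, _, hα, hβ'.mul (hα'.cancel hβ), by push_cast at *; omega,
      by simp only [star_mul, star_star, mul_assoc]⟩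

theorem rhoA_mem_monomials (a : C(X, ℂ)) : rhoA S a ∈ monomials hS 0 :=
  ⟨0, 0, _, _, isWord_zero_iff.2 ⟨a, rfl⟩, isWord_zero_iff.2 ⟨1, rfl⟩, by simp,
    by rw [rhoA_one, star_one, mul_one]⟩

end Words

/-! ### Expansion of words along orbits -/

section Expansion
variable {X : Type*} [TopologicalSpace X] {N : ℕ}

theorem orbit_snoc_castSucc (γ : Fin N → C(X, X)) {n : ℕ} (w : Fin n → Fin N) (k : Fin N) (x : X)
    (i : Fin (n + 1)) :
    orbit γ (Fin.snoc w k : Fin (n + 1) → Fin N) x i.castSucc = orbit γ w x i := by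
  induction i using Fin.induction with
  | zero => rfl
  | succ i ih =>
    rw [← Fin.succ_castSucc, orbit_succ, ih, orbit_succ, Fin.snoc_castSucc]

theorem orbit_snoc_last (γ : Fin N → C(X, X)) {n : ℕ} (w : Fin n → Fin N) (k : Fin N) (x : X) :
    orbit γ (Fin.snoc w k : Fin (n + 1) → Fin N) x (Fin.last (n + 1)) = γ k (wordMap γ w x) := by
  rw [← Fin.succ_last, orbit_succ, orbit_snoc_castSucc, Fin.snoc_last, wordMap]

/-- The function `x ↦ p_m(γ_{w_m ⋯ w_1}(x)) ⋯ p_1(γ_{w_1}(x)) p_0(x)`. -/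
def orbitProd (γ : Fin N → C(X, X)) {m : ℕ} (p : ℕ → C(X, ℂ)) (w : Fin m → Fin N) : C(X, ℂ) :=
  ∏ i : Fin (m + 1), (p i).comp ⟨fun x => orbit γ w x i,
    (continuous_apply i).comp (continuous_orbit γ w)⟩

theorem orbitProd_apply (γ : Fin N → C(X, X)) {m : ℕ} (p : ℕ → C(X, ℂ)) (w : Fin m → Fin N) (x : X) :
    orbitProd γ p w x = ∏ i : Fin (m + 1), p i (orbit γ w x i) := by
  simp only [orbitProd, ContinuousMap.coe_prod, Finset.prod_apply]
  rfl

variable [CompactSpace X] {γ : Fin N → C(X, X)} {S : Set X} (hS : IsRegularSubset γ S)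

theorem wordOp_basisVec (p : ℕ → C(X, ℂ)) (m : ℕ) (x : S) :
    wordOp hS p m (basisVec x)
      = ∑ w : Fin m → Fin N, orbitProd γ p w x • basisVec (wordMapOn hS w x) := by
  induction m with
  | zero =>
    rw [wordOp, rhoA_basisVec, Fintype.sum_unique, orbitProd_apply]
    simp [orbit_zero]
    rfl
  | succ m ih =>
    rw [wordOp, mul_apply_eq_comp, mul_apply_eq_comp, ih, ← (Fin.snocEquiv _).sum_comp,
      Fintype.sum_prod_type_right]
    -- A word of length `m + 1` is a word `w` of length `m` followed by a last letter `k`.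
    simp only [map_sum, map_smul, gen_basisVec, rhoA_basisVec, Finset.smul_sum, smul_smul]
    refine Finset.sum_congr rfl fun w _ => Finset.sum_congr rfl fun k _ => ?_
    have h : wordMapOn hS (Fin.snocEquiv (fun _ => Fin N) (k, w)) x
        = mapOn hS k (wordMapOn hS w x) := Subtype.ext (orbit_snoc_last γ w k x)
    rw [h, orbitProd_apply, orbitProd_apply, Fin.prod_univ_castSucc (n := m + 1)]
    have h1 : ∀ i : Fin (m + 1),
        orbit γ (Fin.snocEquiv (fun _ => Fin N) (k, w)) x i.castSucc = orbit γ w x i :=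
      orbit_snoc_castSucc γ w k x
    have h2 : orbit γ (Fin.snocEquiv (fun _ => Fin N) (k, w)) x (Fin.last (m + 1))
        = mapOn hS k (wordMapOn hS w x) := orbit_snoc_last γ w k x
    simp only [h1, h2, Fin.val_castSucc, Fin.val_last]

theorem wordOp_eq_sum (p : ℕ → C(X, ℂ)) (m : ℕ) :
    wordOp hS p m = ∑ w : Fin m → Fin N,
      push (wordMapOn hS w) (wordMapOn_injective hS w) * rhoA S (orbitProd γ p w) :=
  clm_ext_basisVec fun x => by
    simp only [wordOp_basisVec, sum_apply, mul_apply_eq_comp, rhoA_basisVec, map_smul,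
      push_basisVec]
end Expansion

theorem star_mem_span {A : Type*} [AddCommMonoid A] [StarAddMonoid A] [Module ℂ A]
    [StarModule ℂ A] {s t : Set A} (h : ∀ x ∈ s, star x ∈ t) {x : A}
    (hx : x ∈ Submodule.span ℂ s) : star x ∈ Submodule.span ℂ t := by
  induction hx using Submodule.span_induction with
  | mem x hx => exact Submodule.subset_span (h x hx)
  | zero => simp
  | add x y _ _ hx hy => rw [star_add]; exact Submodule.add_mem _ hx hy
  | smul c x _ hx => rw [star_smul]; exact Submodule.smul_mem _ _ hx

/-! ### Product functions on bichains -/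

section BichainFunctions
variable {X : Type*} [TopologicalSpace X] {N : ℕ}

theorem isClosed_chains [T2Space X] (γ : Fin N → C(X, X)) (n : ℕ) : IsClosed (chains γ n) := by
  simp only [chains, Set.ofPred_forall, Set.ofPred_exists]
  refine isClosed_iInter fun i => isClosed_iUnion_of_finite fun k => isClosed_eq ?_ ?_
  · exact continuous_apply _
  · exact (γ k).continuous.comp (continuous_apply _)

theorem isClosed_bichains [T2Space X] (γ : Fin N → C(X, X)) (m n : ℕ) :
    IsClosed (bichains γ m n) := by
  refine ((isClosed_chains γ m).preimage continuous_fst).inter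
    (((isClosed_chains γ n).preimage continuous_snd).inter (isClosed_eq ?_ ?_))
  · exact (continuous_apply _).comp continuous_fst
  · exact (continuous_apply _).comp continuous_snd

/-- The function `(c, d) ↦ ∏ᵢ p_i(c_i) · ∏ⱼ conj (q_j(d_j))` on the space of bichains. -/
def bichainProd (γ : Fin N → C(X, X)) (m n : ℕ) (p q : ℕ → C(X, ℂ)) : C(bichains γ m n, ℂ) :=
  (∏ i : Fin (m + 1), (p i).comp
      ⟨fun c => c.1.1 i, (continuous_apply i).comp (continuous_fst.comp continuous_subtype_val)⟩) *
    star (∏ j : Fin (n + 1), (q j).comp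
      ⟨fun c => c.1.2 j, (continuous_apply j).comp (continuous_snd.comp continuous_subtype_val)⟩)

theorem bichainProd_apply (γ : Fin N → C(X, X)) (m n : ℕ) (p q : ℕ → C(X, ℂ))
    (c : bichains γ m n) :
    bichainProd γ m n p q c
      = (∏ i : Fin (m + 1), p i (c.1.1 i)) * star (∏ j : Fin (n + 1), q j (c.1.2 j)) := by
  simp only [bichainProd, ContinuousMap.mul_apply, ContinuousMap.star_apply,
    ContinuousMap.coe_prod, Finset.prod_apply]
  rfl

theorem bichainProd_comp (γ : Fin N → C(X, X)) {m n : ℕ} (p q : ℕ → C(X, ℂ))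
    (v : Fin m → Fin N) (w : Fin n → Fin N) :
    (bichainProd γ m n p q).comp (bichainMap γ v w)
      = orbitProd γ p v * star (orbitProd γ q w) := by
  ext x
  rw [ContinuousMap.comp_apply, bichainProd_apply, ContinuousMap.mul_apply,
    ContinuousMap.star_apply, orbitProd_apply, orbitProd_apply]
  rfl

/-- The product functions span a `*`-subalgebra of the continuous functions on the space of
bichains. -/
def bichainProdAlgebra (γ : Fin N → C(X, X)) (m n : ℕ) : StarSubalgebra ℂ C(bichains γ m n, ℂ) where
  carrier := Submodule.span ℂ {f | ∃ p q, f = bichainProd γ m n p q}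
  mul_mem' {f g} hf hg := by
    refine Submodule.mul_le.1 (?_ : Submodule.span ℂ _ * Submodule.span ℂ _ ≤ _) f hf g hg
    rw [Submodule.span_mul_span]
    refine Submodule.span_mono ?_
    rintro _ ⟨_, ⟨p, q, rfl⟩, _, ⟨p', q', rfl⟩, rfl⟩
    refine ⟨fun i => p i * p' i, fun i => q i * q' i, ?_⟩
    ext c
    simp only [bichainProd_apply, ContinuousMap.mul_apply, Finset.prod_mul_distrib, star_mul]
    ring
  add_mem' := Submodule.add_mem _
  algebraMap_mem' c := by
    rw [Algebra.algebraMap_eq_smul_one]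
    refine Submodule.smul_mem _ _ (Submodule.subset_span ⟨1, 1, ?_⟩)
    ext d
    simp [bichainProd_apply]
  star_mem' {f} hf := by
    refine star_mem_span ?_ hf
    rintro _ ⟨p, q, rfl⟩
    refine ⟨fun i => star (p i), fun i => star (q i), ?_⟩
    ext c
    simp [bichainProd_apply]

theorem separatesPoints_bichainProdAlgebra [CompactSpace X] [T2Space X] (γ : Fin N → C(X, X))
    (m n : ℕ) : (bichainProdAlgebra γ m n).SeparatesPoints := by
  have sep : ∀ x y : X, x ≠ y → ∃ a : C(X, ℂ), a x ≠ a y := fun x y hxy => by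
    obtain ⟨a, hx, hy⟩ := exists_eq_zero_eq_one hxy
    exact ⟨a, by simp [hx, hy]⟩
  intro c d hcd
  have hcd' : (∃ i, c.1.1 i ≠ d.1.1 i) ∨ ∃ j, c.1.2 j ≠ d.1.2 j := by
    by_contra! h
    exact hcd (Subtype.ext (Prod.ext (funext h.1) (funext h.2)))
  -- A coordinate function is a product function with all other factors equal to `1`.
  have val : ∀ {k : ℕ} (i : Fin (k + 1)) (a : C(X, ℂ)) (e : Fin (k + 1) → X),
      ∏ l : Fin (k + 1), (if (l : ℕ) = i then a else 1) (e l) = a (e i) := by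
    intro k i a e
    rw [Finset.prod_eq_single i]
    · simp
    · intro l _ hl
      rw [if_neg (fun h => hl (Fin.ext h)), ContinuousMap.one_apply]
    · simp
  rcases hcd' with ⟨i, hi⟩ | ⟨j, hj⟩
  · obtain ⟨a, ha⟩ := sep _ _ hi
    refine ⟨_, ⟨_, Submodule.subset_span ⟨fun l => if l = i then a else 1, 1, rfl⟩, rfl⟩, ?_⟩
    simpa [bichainProd_apply, val] using ha
  · obtain ⟨a, ha⟩ := sep _ _ hj
    refine ⟨_, ⟨_, Submodule.subset_span ⟨1, fun l => if l = j then a else 1, rfl⟩, rfl⟩, ?_⟩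
    refine fun h => ha ((starRingEnd ℂ).injective ?_)
    simpa [bichainProd_apply, val] using h

end BichainFunctions

/-! ### The spaces of degree `k` -/

section DegreeSpaces
variable {X : Type*} [TopologicalSpace X] [CompactSpace X] {N : ℕ}
variable {γ : Fin N → C(X, X)} {S : Set X} (hS : IsRegularSubset γ S)

theorem rhoBi_bichainProd (m n : ℕ) (p q : ℕ → C(X, ℂ)) :
    rhoBi hS m n (bichainProd γ m n p q) = wordOp hS p m * star (wordOp hS q n) := by
  simp only [rhoBi, LinearMap.coe_mk, AddHom.coe_mk, wordOp_eq_sum, star_sum,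
    Finset.sum_mul_sum, bichainProd_comp, rhoA_mul, star_mul, star_rhoA, mul_assoc]
  rfl

theorem continuous_rhoBi (m n : ℕ) : Continuous (rhoBi hS m n) := by
  refine continuous_finsetSum _ fun v _ => continuous_finsetSum _ fun w _ => ?_
  exact continuous_const.clm_comp
    (((continuous_rhoA S).comp (ContinuousMap.continuous_precomp _)).clm_comp continuous_const)

variable {hS} in
theorem monomials_subset_Bspace (k : ℤ) : monomials hS k ⊆ Bspace hS k := by
  rintro _ ⟨m, n, _, _, ⟨p, rfl⟩, ⟨q, rfl⟩, hk, rfl⟩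
  refine Submodule.le_topologicalClosure _ ?_
  exact Submodule.mem_iSup_of_mem m <| Submodule.mem_iSup_of_mem n <|
    Submodule.mem_iSup_of_mem hk ⟨_, rhoBi_bichainProd hS m n p q⟩

/-- By the Stone–Weierstrass theorem, the reduced monomials of degree `k` are total in `B_k`. -/
theorem Bspace_eq [T2Space X] (k : ℤ) :
    Bspace hS k = (Submodule.span ℂ (monomials hS k)).topologicalClosure := by
  refine le_antisymm (Submodule.topologicalClosure_minimal _ ?_
    (Submodule.isClosed_topologicalClosure _)) (Submodule.topologicalClosure_minimal _
    (Submodule.span_le.2 (monomials_subset_Bspace k)) (Submodule.isClosed_topologicalClosure _))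
  refine iSup_le fun m => iSup_le fun n => iSup_le fun hk => ?_
  rintro _ ⟨f, rfl⟩
  have : CompactSpace (bichains γ m n) :=
    isCompact_iff_compactSpace.1 (isClosed_bichains γ m n).isCompact
  have hf : f ∈ (bichainProdAlgebra γ m n).topologicalClosure :=
    ContinuousMap.starSubalgebra_topologicalClosure_eq_top_of_separatesPoints _
      (separatesPoints_bichainProdAlgebra γ m n) ▸ StarSubalgebra.mem_top
  refine map_mem_closure (continuous_rhoBi hS m n) hf fun g hg => ?_
  have hg' : rhoBi hS m n g ∈ (Submodule.span ℂ _).map (rhoBi hS m n) :=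
    Submodule.mem_map_of_mem hg
  refine (Submodule.map_span_le _ _ _).2 ?_ hg'
  rintro _ ⟨p, q, rfl⟩
  exact Submodule.subset_span ⟨m, n, _, _, ⟨p, rfl⟩, ⟨q, rfl⟩, hk, rhoBi_bichainProd hS m n p q⟩

theorem Bspace_mul [T2Space X] {k l : ℤ} {α β : SqMatrix S} (hα : α ∈ Bspace hS k)
    (hβ : β ∈ Bspace hS l) : α * β ∈ Bspace hS (k + l) := by
  rw [Bspace_eq] at *
  refine map_mem_closure₂ continuous_mul hα hβ fun a ha b hb => ?_
  refine Submodule.mul_le.1 (?_ : Submodule.span ℂ _ * Submodule.span ℂ _ ≤ _) a ha b hb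
  rw [Submodule.span_mul_span]
  refine Submodule.span_mono ?_
  rintro _ ⟨μ, hμ, ν, hν, rfl⟩
  exact mul_mem_monomials hμ hν

theorem star_mem_Bspace [T2Space X] {k : ℤ} {α : SqMatrix S} (hα : α ∈ Bspace hS k) :
    star α ∈ Bspace hS (-k) := by
  rw [Bspace_eq] at *
  exact map_mem_closure continuous_star hα fun a ha =>
    star_mem_span (fun _ => star_mem_monomials) ha

end DegreeSpaces

/-! ### Closed direct sums and Fourier coefficients -/

section Graded
variable {S : Type*}

/-- The operators `α ⊗ υ_k` with `α` in the `k`-th space of a family. -/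
def gradedTensors (F : ℤ → Submodule ℂ (SqMatrix S)) : Set (BigAlg S) :=
  {T | ∃ k : ℤ, ∃ α ∈ F k, T = opTensor α (upsilon k)}

/-- The closed direct sum `⨁ₖ F_k ⊗ υ_k` of a family of spaces of matrices, as a `*`-subalgebra
when the family is compatible with products and adjoints. -/
def gradedAlgebra (F : ℤ → Submodule ℂ (SqMatrix S))
    (hmul : ∀ {k l α β}, α ∈ F k → β ∈ F l → α * β ∈ F (k + l))
    (hstar : ∀ {k α}, α ∈ F k → star α ∈ F (-k)) : NonUnitalStarSubalgebra ℂ (BigAlg S) where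
  __ := (Submodule.span ℂ (gradedTensors F)).topologicalClosure
  mul_mem' {P Q} hP hQ := by
    refine map_mem_closure₂ continuous_mul hP hQ fun a ha b hb => ?_
    refine Submodule.mul_le.1 (?_ : Submodule.span ℂ _ * Submodule.span ℂ _ ≤ _) a ha b hb
    rw [Submodule.span_mul_span]
    refine Submodule.span_mono ?_
    rintro _ ⟨_, ⟨k, α, hα, rfl⟩, _, ⟨l, β, hβ, rfl⟩, rfl⟩
    exact ⟨k + l, α * β, hmul hα hβ, by simp only [opTensor_mul, upsilon_mul]⟩
  star_mem' {P} hP := by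
    refine map_mem_closure continuous_star hP fun a ha => star_mem_span ?_ ha
    rintro _ ⟨k, α, hα, rfl⟩
    exact ⟨-k, star α, hstar hα, by rw [star_opTensor, star_upsilon]⟩

/-- The `k`-th Fourier coefficient of an operator on `ℓ²(S) ⊗ ℓ²(ℤ)`: the block taking
`ℓ²(S) ⊗ e_0` to `ℓ²(S) ⊗ e_k`. -/
def fourierCoef (k : ℤ) : BigAlg S →L[ℂ] SqMatrix S where
  toFun T := ContinuousLinearMap.adjoint (tmulRight (HSpace S) (basisVec k)) ∘L T ∘L
    tmulRight (HSpace S) (basisVec (0 : ℤ))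
  map_add' P Q := by rw [ContinuousLinearMap.add_comp, ContinuousLinearMap.comp_add]
  map_smul' c P := by
    rw [ContinuousLinearMap.smul_comp, ContinuousLinearMap.comp_smul, RingHom.id_apply]
  cont := continuous_const.clm_comp (continuous_id.clm_comp continuous_const)

theorem fourierCoef_apply (k : ℤ) (T : BigAlg S) (v : HSpace S) :
    fourierCoef k T v = ContinuousLinearMap.adjoint (tmulRight (HSpace S) (basisVec k))
      (T (HTensor.tmul v (basisVec 0))) := rfl

theorem fourierCoef_opTensor (k l : ℤ) (α : SqMatrix S) :
    fourierCoef k (opTensor α (upsilon l)) = if l = k then α else 0 := by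
  ext1 v
  rw [fourierCoef_apply, opTensor_tmul, upsilon_basisVec, add_zero, adjoint_tmulRight_tmul,
    inner_basisVec]
  split_ifs with h
  · rw [h, basisVec_self, one_smul]
  · rw [basisVec_ne (Ne.symm h), zero_smul]
    rfl

theorem fourierCoef_mul_opTensor_one (k : ℤ) (T : BigAlg S) (α : SqMatrix S) :
    fourierCoef k (T * opTensor α 1) = fourierCoef k T * α := by
  ext1 v
  rw [mul_apply_eq_comp, fourierCoef_apply, fourierCoef_apply, mul_apply_eq_comp, opTensor_tmul,
    one_apply_eq_self]

theorem fourierCoef_opTensor_one_mul (k : ℤ) (T : BigAlg S) (α : SqMatrix S) :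
    fourierCoef k (opTensor α 1 * T) = α * fourierCoef k T := by
  have h : ContinuousLinearMap.adjoint (tmulRight (HSpace S) (basisVec k)) ∘L
      opTensor α (1 : SqMatrix ℤ)
        = α ∘L ContinuousLinearMap.adjoint (tmulRight (HSpace S) (basisVec k)) :=
    HTensor.clm_ext fun v w => by
      simp only [ContinuousLinearMap.comp_apply, opTensor_tmul, adjoint_tmulRight_tmul,
        one_apply_eq_self, map_smul]
  ext1 v
  exact congrArg (fun P => P (T (HTensor.tmul v (basisVec 0)))) h

theorem fourierCoef_mem {F : ℤ → Submodule ℂ (SqMatrix S)} (k : ℤ)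
    (hF : IsClosed (F k : Set (SqMatrix S))) {T : BigAlg S}
    (hT : T ∈ (Submodule.span ℂ (gradedTensors F)).topologicalClosure) :
    fourierCoef k T ∈ F k := by
  refine Submodule.topologicalClosure_minimal _
    (t := (F k).comap (fourierCoef (S := S) k).toLinearMap) ?_ ?_ hT
  · rw [Submodule.span_le]
    rintro _ ⟨l, α, hα, rfl⟩
    change fourierCoef k _ ∈ F k
    rw [fourierCoef_opTensor]
    split_ifs with h
    · exact h ▸ hα
    · exact Submodule.zero_mem _
  · exact hF.preimage (fourierCoef k).continuous

end Graded

/-! ### Fejér means -/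

section Fejer
variable {S : Type*}

theorem norm_zpow_smul_basisVec (z : Circle) (k : ℤ) :
    ‖(z : ℂ) ^ k • (basisVec k : HSpace ℤ)‖ = 1 := by
  rw [norm_smul, norm_zpow, Circle.norm_coe, one_zpow, norm_basisVec, one_mul]

theorem orthogonalFamily_rotation (z : Circle) :
    OrthogonalFamily ℂ (fun _ : ℤ => ℂ)
      (fun k => LinearIsometry.toSpanSingleton ℂ (HSpace ℤ) (norm_zpow_smul_basisVec z k)) := by
  intro j k hjk a b
  simp only [LinearIsometry.toSpanSingleton_apply, inner_smul_left, inner_smul_right,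
    inner_basisVec]
  rw [basisVec_ne hjk]
  simp

/-- The unitary `e_k ↦ z^k e_k` on `ℓ²(ℤ)`. -/
def rotation (z : Circle) : SqMatrix ℤ :=
  (orthogonalFamily_rotation z).linearIsometry.toContinuousLinearMap

theorem rotation_basisVec (z : Circle) (k : ℤ) :
    rotation z (basisVec k) = (z : ℂ) ^ k • basisVec k := by
  classical
  have h := (orthogonalFamily_rotation z).linearIsometry_apply_single (i := k) (1 : ℂ)
  have h2 : (basisVec k : HSpace ℤ) = lp.single 2 k (1 : ℂ) := by
    unfold basisVec
    congr!
  rw [rotation, LinearIsometry.coe_toContinuousLinearMap]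
  conv_lhs => rw [h2]
  rw [h, LinearIsometry.toSpanSingleton_apply, one_smul]

theorem norm_rotation_le (z : Circle) : ‖rotation z‖ ≤ 1 :=
  LinearIsometry.norm_toContinuousLinearMap_le _

theorem rotation_mul_upsilon_mul_rotation_inv (z : Circle) (k : ℤ) :
    rotation z * upsilon k * rotation z⁻¹ = (z : ℂ) ^ k • upsilon k :=
  clm_ext_basisVec fun j => by
    simp only [mul_apply_eq_comp, rotation_basisVec, map_smul, upsilon_basisVec, smul_smul,
      smul_apply]
    rw [Circle.coe_inv, inv_zpow, add_comm k j, zpow_add₀ (Circle.coe_ne_zero z),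
      inv_mul_cancel_left₀ (zpow_ne_zero _ (Circle.coe_ne_zero z))]

/-- The dual action of `z` on operators on `ℓ²(S) ⊗ ℓ²(ℤ)`, conjugation by `1 ⊗ rotation z`. -/
def gauge (z : Circle) : BigAlg S →ₗ[ℂ] BigAlg S where
  toFun T := opTensor 1 (rotation z) * T * opTensor 1 (rotation z⁻¹)
  map_add' P Q := by rw [mul_add, add_mul]
  map_smul' c P := by rw [mul_smul_comm, smul_mul_assoc, RingHom.id_apply]

theorem gauge_opTensor (z : Circle) (α : SqMatrix S) (k : ℤ) :
    gauge z (opTensor α (upsilon k)) = (z : ℂ) ^ k • opTensor α (upsilon k) := by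
  change opTensor 1 _ * _ * opTensor 1 _ = _
  rw [opTensor_mul, opTensor_mul, one_mul, mul_one, rotation_mul_upsilon_mul_rotation_inv,
    opTensor_smul_right]

theorem norm_gauge_le (z : Circle) (T : BigAlg S) : ‖gauge z T‖ ≤ ‖T‖ := by
  have h : ∀ z : Circle, ‖opTensor (1 : SqMatrix S) (rotation z)‖ ≤ 1 := fun z =>
    (norm_opTensor_le _ _).trans
      (mul_le_one₀ ContinuousLinearMap.norm_id_le (norm_nonneg _) (norm_rotation_le z))
  calc ‖gauge z T‖ ≤ ‖opTensor 1 (rotation z)‖ * ‖T‖ * ‖opTensor 1 (rotation z⁻¹)‖ :=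
        (norm_mul_le _ _).trans (mul_le_mul_of_nonneg_right (norm_mul_le _ _) (norm_nonneg _))
    _ ≤ 1 * ‖T‖ * 1 := by gcongr <;> exact h _
    _ = ‖T‖ := by ring

/-- The `n`-th Fejér mean `∑_{|k| < n} (1 - |k| / n) Φ_k(T) ⊗ υ_k` of the Fourier series of an
operator. The coefficient `1 - |k| / n` appears as `n⁻¹` times the number of pairs `i, j < n`
with `i - j = k`; the mean for `n = 0` is `0`. -/
def fejer (n : ℕ) : BigAlg S →L[ℂ] BigAlg S :=
  (n : ℂ)⁻¹ • ∑ i ∈ Finset.range n, ∑ j ∈ Finset.range n,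
    (opTensorL (HSpace S) (upsilon (i - j : ℤ))).comp (fourierCoef (i - j : ℤ))

theorem fejer_apply (n : ℕ) (T : BigAlg S) :
    fejer n T = (n : ℂ)⁻¹ • ∑ i ∈ Finset.range n, ∑ j ∈ Finset.range n,
      opTensor (fourierCoef (i - j : ℤ) T) (upsilon (i - j : ℤ)) := by
  simp only [fejer, smul_apply, sum_apply, ContinuousLinearMap.comp_apply, opTensorL_apply]

theorem fejer_opTensor (n : ℕ) (k : ℤ) (α : SqMatrix S) :
    fejer n (opTensor α (upsilon k)) = ((n : ℂ)⁻¹ * ∑ i ∈ Finset.range n, ∑ j ∈ Finset.range n,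
      if k = (i - j : ℤ) then 1 else 0) • opTensor α (upsilon k) := by
  rw [fejer_apply, mul_smul, Finset.sum_smul]
  congr 1
  refine Finset.sum_congr rfl fun i _ => ?_
  rw [Finset.sum_smul]
  refine Finset.sum_congr rfl fun j _ => ?_
  rw [fourierCoef_opTensor]
  split_ifs with h
  · rw [one_smul, h]
  · rw [zero_smul, ← opTensorL_apply, map_zero]

theorem sum_sum_ite_eq_sub (n : ℕ) (k : ℤ) :
    (∑ i ∈ Finset.range n, ∑ j ∈ Finset.range n, if k = (i - j : ℤ) then (1 : ℂ) else 0)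
      = ((n - k.natAbs : ℕ) : ℂ) := by
  -- For given `i` there is at most one `j`, namely `i - k`, and it is in range exactly when
  -- `k ≤ i < n + k`. Truncation in `toNat` and in `n - k.natAbs` makes the count `0` for `|k| ≥ n`.
  have h1 : ∀ i ∈ Finset.range n,
      (∑ j ∈ Finset.range n, if k = (i - j : ℤ) then (1 : ℂ) else 0)
        = if i ∈ Finset.Ico k.toNat (min n (n + k).toNat) then 1 else 0 := by
    intro i hi
    rw [Finset.mem_range] at hi
    refine Eq.trans ?_ ((Finset.sum_ite_eq' (Finset.range n) (i - k).toNat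
      (fun _ => if k ≤ i then (1 : ℂ) else 0)).trans ?_)
    · refine Finset.sum_congr rfl fun j hj => ?_
      rw [← ite_and]
      exact if_congr (by omega) rfl rfl
    · rw [← ite_and]
      refine if_congr ?_ rfl rfl
      rw [Finset.mem_range, Finset.mem_Ico]
      omega
  rw [Finset.sum_congr rfl h1, Finset.sum_ite_mem, Finset.inter_eq_right.2, Finset.sum_const,
    Nat.card_Ico, nsmul_one]
  · congr 1
    omega
  · intro i hi
    rw [Finset.mem_Ico] at hi
    rw [Finset.mem_range]
    omega

theorem tendsto_fejer_opTensor (k : ℤ) (α : SqMatrix S) :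
    Filter.Tendsto (fun n => fejer n (opTensor α (upsilon k))) Filter.atTop
      (nhds (opTensor α (upsilon k))) := by
  have h : Filter.Tendsto (fun n : ℕ => 1 - (k.natAbs : ℂ) / n) Filter.atTop (nhds (1 - 0)) :=
    tendsto_const_nhds.sub (tendsto_const_div_atTop_nhds_zero_nat _)
  rw [sub_zero] at h
  have h' := h.smul_const (opTensor α (upsilon k))
  rw [one_smul] at h'
  refine h'.congr' ?_
  filter_upwards [Filter.eventually_ge_atTop k.natAbs, Filter.eventually_gt_atTop 0] with n hn hn0
  rw [fejer_opTensor, sum_sum_ite_eq_sub, Nat.cast_sub hn]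
  have : (n : ℂ) ≠ 0 := Nat.cast_ne_zero.2 hn0.ne'
  congr 1
  field_simp

theorem sum_pow_zpow_of_isPrimitiveRoot {ζ : ℂ} {M : ℕ} (hζ : IsPrimitiveRoot ζ M)
    (s : ℤ) : ∑ r ∈ Finset.range M, (ζ ^ r) ^ s = if (M : ℤ) ∣ s then (M : ℂ) else 0 := by
  have h : ∀ r : ℕ, (ζ ^ r) ^ s = (ζ ^ s) ^ r := fun r => by
    rw [← zpow_natCast, ← zpow_natCast, zpow_comm]
  simp only [h]
  split_ifs with hd
  · rw [(hζ.zpow_eq_one_iff_dvd s).2 hd]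
    simp
  · have h1 : ζ ^ s ≠ 1 := mt (hζ.zpow_eq_one_iff_dvd s).1 hd
    rw [geom_sum_eq h1, ← h, hζ.pow_eq_one, one_zpow, sub_self, zero_div]

/-- The Fejér kernel `n⁻¹ |1 + z + ⋯ + z^{n-1}|²`. -/
def fejerKernel (n : ℕ) (z : Circle) : ℝ := ‖∑ i ∈ Finset.range n, (z : ℂ) ^ i‖ ^ 2 / n

theorem fejerKernel_eq_sum (n : ℕ) (z : Circle) :
    (fejerKernel n z : ℂ)
      = (n : ℂ)⁻¹ * ∑ i ∈ Finset.range n, ∑ j ∈ Finset.range n, (z : ℂ) ^ (j - i : ℤ) := by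
  rw [fejerKernel, Complex.ofReal_div, Complex.ofReal_pow, ← Complex.conj_mul', map_sum,
    Finset.sum_mul_sum, div_eq_inv_mul, Complex.ofReal_natCast]
  congr 1
  refine Finset.sum_congr rfl fun i _ => Finset.sum_congr rfl fun j _ => ?_
  rw [map_pow, ← Circle.coe_inv_eq_conj, Circle.coe_inv, zpow_sub₀ (Circle.coe_ne_zero z),
    zpow_natCast, zpow_natCast, inv_pow, div_eq_inv_mul]

/-- A primitive `M`-th root of unity on the circle. -/
def circleRoot (M : ℕ) : Circle := Circle.exp (2 * Real.pi / M)

theorem isPrimitiveRoot_circleRoot {M : ℕ} (hM : M ≠ 0) :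
    IsPrimitiveRoot (circleRoot M : ℂ) M := by
  convert Complex.isPrimitiveRoot_exp M hM using 1
  rw [circleRoot, Circle.coe_exp]
  congr 1
  push_cast
  ring

/-- The Fourier coefficients of the Fejér kernel, computed by sampling at the `M`-th roots of
unity; there is no aliasing once `M ≥ n + |k|`. -/
theorem sum_fejerKernel_mul_zpow {n M : ℕ} (k : ℤ) (hM : M ≠ 0) (h : n + k.natAbs ≤ M) :
    ∑ r ∈ Finset.range M, ((fejerKernel n (circleRoot M ^ r) / M : ℝ) : ℂ) *
        ((circleRoot M ^ r : Circle) : ℂ) ^ k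
      = (n : ℂ)⁻¹ * ∑ i ∈ Finset.range n, ∑ j ∈ Finset.range n,
        if k = (i - j : ℤ) then 1 else 0 := by
  have hM' : (M : ℂ) ≠ 0 := Nat.cast_ne_zero.2 hM
  calc _ = ∑ r ∈ Finset.range M, (n : ℂ)⁻¹ * ∑ i ∈ Finset.range n, ∑ j ∈ Finset.range n,
          (M : ℂ)⁻¹ * ((circleRoot M : ℂ) ^ r) ^ (j - i + k : ℤ) := by
        refine Finset.sum_congr rfl fun r _ => ?_
        rw [Complex.ofReal_div, fejerKernel_eq_sum, Complex.ofReal_natCast, div_mul_eq_mul_div,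
          mul_assoc, mul_div_assoc, Finset.sum_mul, Finset.sum_div]
        congr 1
        refine Finset.sum_congr rfl fun i _ => ?_
        rw [Finset.sum_mul, Finset.sum_div]
        refine Finset.sum_congr rfl fun j _ => ?_
        rw [← zpow_add₀ (Circle.coe_ne_zero _), div_eq_inv_mul, Circle.coe_pow]
    _ = _ := by
        rw [← Finset.mul_sum, Finset.sum_comm]
        congr 1
        refine Finset.sum_congr rfl fun i hi => ?_
        rw [Finset.sum_comm]
        refine Finset.sum_congr rfl fun j hj => ?_
        rw [Finset.mem_range] at hi hj
        rw [← Finset.mul_sum, sum_pow_zpow_of_isPrimitiveRoot (isPrimitiveRoot_circleRoot hM),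
          mul_ite, inv_mul_cancel₀ hM', mul_zero]
        refine if_congr ⟨fun hd => ?_, fun hk => ⟨0, by omega⟩⟩ rfl rfl
        -- `|j - i + k| < n + |k| ≤ M`
        have := Int.eq_zero_of_abs_lt_dvd hd (by rw [abs_lt]; omega)
        omega

/-- The average of the gauge action over the `M`-th roots of unity, weighted by the Fejér
kernel. -/
def gaugeMean (n M : ℕ) : BigAlg S →ₗ[ℂ] BigAlg S :=
  ∑ r ∈ Finset.range M,
    ((fejerKernel n (circleRoot M ^ r) / M : ℝ) : ℂ) • gauge (circleRoot M ^ r)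

theorem gaugeMean_opTensor {n M : ℕ} (k : ℤ) (hM : M ≠ 0) (h : n + k.natAbs ≤ M)
    (α : SqMatrix S) :
    gaugeMean n M (opTensor α (upsilon k)) = fejer n (opTensor α (upsilon k)) := by
  rw [fejer_opTensor, ← sum_fejerKernel_mul_zpow k hM h, Finset.sum_smul, gaugeMean,
    LinearMap.sum_apply]
  refine Finset.sum_congr rfl fun r _ => ?_
  rw [LinearMap.smul_apply, gauge_opTensor, smul_smul]

theorem norm_gaugeMean_le {n M : ℕ} (hn : n ≠ 0) (h : n ≤ M) (T : BigAlg S) :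
    ‖gaugeMean n M T‖ ≤ ‖T‖ := by
  have hn' : (n : ℂ) ≠ 0 := Nat.cast_ne_zero.2 hn
  have hsum : ∑ r ∈ Finset.range M, fejerKernel n (circleRoot M ^ r) / M = 1 := by
    have h0 := sum_fejerKernel_mul_zpow (n := n) (M := M) 0 (by omega) (by simpa using h)
    rw [sum_sum_ite_eq_sub] at h0
    simp only [zpow_zero, mul_one, Int.natAbs_zero, Nat.sub_zero, inv_mul_cancel₀ hn'] at h0
    exact_mod_cast h0
  have hpos : ∀ z, 0 ≤ fejerKernel n z / M := fun z => by unfold fejerKernel; positivity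
  rw [gaugeMean, LinearMap.sum_apply]
  calc _ ≤ ∑ r ∈ Finset.range M, fejerKernel n (circleRoot M ^ r) / M * ‖T‖ := by
        refine norm_sum_le_of_le _ fun r _ => ?_
        rw [LinearMap.smul_apply, norm_smul, Complex.norm_real, Real.norm_of_nonneg (hpos _)]
        exact mul_le_mul_of_nonneg_left (norm_gauge_le _ _) (hpos _)
    _ = ‖T‖ := by rw [← Finset.sum_mul, hsum, one_mul]

/-- The Fejér means are contractive on the closed span of the operators `α ⊗ υ_k`: on finite sums
they are averages of the gauge action with respect to a probability measure. -/
theorem norm_fejer_le (n : ℕ) {F : ℤ → Submodule ℂ (SqMatrix S)} {T : BigAlg S}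
    (hT : T ∈ (Submodule.span ℂ (gradedTensors F)).topologicalClosure) :
    ‖fejer n T‖ ≤ ‖T‖ := by
  rcases eq_or_ne n 0 with rfl | hn
  · simp [fejer_apply]
  refine closure_minimal (t := {T : BigAlg S | ‖fejer n T‖ ≤ ‖T‖}) (fun P hP => ?_)
    (isClosed_le (fejer n).continuous.norm continuous_norm) hT
  -- A finite sum involves finitely many degrees, so sampling is exact for all large `M`.
  have key : ∀ᶠ M in Filter.atTop, gaugeMean n M P = fejer n P := by
    induction hP using Submodule.span_induction with
    | mem P hP =>
      obtain ⟨k, α, -, rfl⟩ := hP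
      filter_upwards [Filter.eventually_ge_atTop (n + k.natAbs),
        Filter.eventually_ne_atTop 0] with M h hM
      exact gaugeMean_opTensor k hM h α
    | zero => simp
    | add P Q _ _ hP hQ =>
      filter_upwards [hP, hQ] with M h h'
      rw [map_add, map_add, h, h']
    | smul c P _ hP =>
      filter_upwards [hP] with M h
      rw [map_smul, map_smul, h]
  obtain ⟨M, hM, h⟩ := (key.and (Filter.eventually_ge_atTop n)).exists
  exact (congrArg norm hM).symm.trans_le (norm_gaugeMean_le hn h P)

/-- Convergence of the Fejér means in norm. -/
theorem tendsto_fejer {F : ℤ → Submodule ℂ (SqMatrix S)} {T : BigAlg S}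
    (hT : T ∈ (Submodule.span ℂ (gradedTensors F)).topologicalClosure) :
    Filter.Tendsto (fun n => fejer n T) Filter.atTop (nhds T) := by
  have hspan : ∀ P ∈ Submodule.span ℂ (gradedTensors F),
      Filter.Tendsto (fun n => fejer n P) Filter.atTop (nhds P) := by
    intro P hP
    induction hP using Submodule.span_induction with
    | mem P hP =>
      obtain ⟨k, α, -, rfl⟩ := hP
      exact tendsto_fejer_opTensor k α
    | zero => simp
    | add P Q _ _ hP hQ => simpa only [map_add] using hP.add hQ
    | smul c P _ hP => simpa only [map_smul] using hP.const_smul c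
  rw [Metric.tendsto_atTop]
  intro ε hε
  obtain ⟨P, hP, hTP⟩ := Metric.mem_closure_iff.1 hT (ε / 3) (by positivity)
  obtain ⟨n₀, hn₀⟩ := Metric.tendsto_atTop.1 (hspan P hP) (ε / 3) (by positivity)
  refine ⟨n₀, fun n hn => ?_⟩
  have h1 : dist (fejer n T) (fejer n P) < ε / 3 := by
    rw [dist_eq_norm, ← map_sub]
    refine (norm_fejer_le n (F := F) ?_).trans_lt (dist_eq_norm T P ▸ hTP)
    exact Submodule.sub_mem _ hT (Submodule.le_topologicalClosure _ hP)
  have h2 := hn₀ n hn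
  have h3 := dist_triangle4 (fejer n T) (fejer n P) P T
  rw [dist_comm P T] at h3
  linarith

/-- An operator in the closed span of the operators `α ⊗ υ_k` lies in a closed direct sum
`⨁ₖ F_k ⊗ υ_k` as soon as its Fourier coefficients lie in the spaces `F_k`. -/
theorem mem_of_fourierCoef_mem {F F' : ℤ → Submodule ℂ (SqMatrix S)} {T : BigAlg S}
    (hT : T ∈ (Submodule.span ℂ (gradedTensors F')).topologicalClosure)
    (h : ∀ k, fourierCoef k T ∈ F k) :
    T ∈ (Submodule.span ℂ (gradedTensors F)).topologicalClosure := by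
  refine mem_closure_of_tendsto (tendsto_fejer hT) (Filter.Eventually.of_forall fun n => ?_)
  change fejer n T ∈ Submodule.span ℂ (gradedTensors F)
  rw [fejer_apply]
  exact Submodule.smul_mem _ _ (Submodule.sum_mem _ fun i _ => Submodule.sum_mem _ fun j _ =>
    Submodule.subset_span ⟨_, _, h _, rfl⟩)

end Fejer

/-! ### The maximal abelian subalgebra -/

section Masa
variable {X : Type*} [TopologicalSpace X] [CompactSpace X] {N : ℕ}
variable {γ : Fin N → C(X, X)} {S : Set X} (hS : IsRegularSubset γ S)

theorem rhoHatA_eq (a : C(X, ℂ)) : rhoHatA S a = opTensor (rhoA S a) 1 := by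
  rw [rhoHatA, upsilon_zero]

theorem rhoHatA_mem_cstarHat (a : C(X, ℂ)) : rhoHatA S a ∈ cstarHat hS :=
  NonUnitalStarSubalgebra.le_topologicalClosure _
    (NonUnitalStarAlgebra.subset_adjoin ℂ _ (Or.inl ⟨a, rfl⟩))

theorem rhoHatE_mem_cstarHat (f : C(graph γ, ℂ)) : rhoHatE hS f ∈ cstarHat hS :=
  NonUnitalStarSubalgebra.le_topologicalClosure _
    (NonUnitalStarAlgebra.subset_adjoin ℂ _ (Or.inr ⟨f, rfl⟩))

theorem opTensor_wordOp_mem_cstarHat (p : ℕ → C(X, ℂ)) (m : ℕ) :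
    opTensor (wordOp hS p m) (upsilon m) ∈ cstarHat hS := by
  induction m with
  | zero => exact rhoHatA_mem_cstarHat hS (p 0)
  | succ m ih =>
    have := mul_mem (rhoHatA_mem_cstarHat hS (p (m + 1)))
      (mul_mem (rhoHatE_mem_cstarHat hS 1) ih)
    rw [rhoHatA, rhoHatE, opTensor_mul, opTensor_mul, upsilon_mul, upsilon_mul, zero_add] at this
    rwa [Nat.cast_succ, add_comm (m : ℤ)]

theorem opTensor_mem_cstarHat [T2Space X] {k : ℤ} {α : SqMatrix S} (hα : α ∈ Bspace hS k) :
    opTensor α (upsilon k) ∈ cstarHat hS := by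
  rw [Bspace_eq] at hα
  refine Submodule.topologicalClosure_minimal _
    (t := (cstarHat hS).toSubmodule.comap (opTensorL (HSpace S) (upsilon k)).toLinearMap)
    ?_ ?_ hα
  · rw [Submodule.span_le]
    rintro _ ⟨m, n, _, _, ⟨p, rfl⟩, ⟨q, rfl⟩, rfl, rfl⟩
    have := mul_mem (opTensor_wordOp_mem_cstarHat hS p m)
      (star_mem (opTensor_wordOp_mem_cstarHat hS q n))
    rwa [star_opTensor, star_upsilon, opTensor_mul, upsilon_mul, ← sub_eq_add_neg] at this
  · exact (NonUnitalStarSubalgebra.isClosed_topologicalClosure _).preimage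
      (opTensorL (HSpace S) (upsilon k)).continuous

theorem rhoA_mem_Bspace (a : C(X, ℂ)) : rhoA S a ∈ Bspace hS 0 :=
  monomials_subset_Bspace 0 (rhoA_mem_monomials a)

theorem rhoE_mem_Bspace (f : C(graph γ, ℂ)) : rhoE hS f ∈ Bspace hS 1 := by
  refine Submodule.le_topologicalClosure _ <| Submodule.mem_iSup_of_mem 1 <|
    Submodule.mem_iSup_of_mem 0 <| Submodule.mem_iSup_of_mem (by norm_num) ?_
  -- The second chain of a bichain of length `(1, 0)` is the starting point of the first one, which
  -- is determined by the point `(c 1, c 0)` of the graph.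
  let φ : C(bichains γ 1 0, graph γ) :=
    ⟨fun c => ⟨(c.1.1 1, c.1.1 0), c.2.1 0⟩,
      (((continuous_apply 1).comp (continuous_fst.comp continuous_subtype_val)).prodMk
        ((continuous_apply 0).comp (continuous_fst.comp continuous_subtype_val))).subtype_mk _⟩
  refine ⟨f.comp φ, clm_ext_basisVec fun x => ?_⟩
  have h := rhoBi_basisVec hS (f.comp φ) (Fin.elim0 : Fin 0 → Fin N) x
  rw [show wordMapOn hS (Fin.elim0 : Fin 0 → Fin N) x = x from rfl] at h
  rw [h, rhoE_basisVec, ← (Equiv.funUnique (Fin 1) (Fin N)).symm.sum_comp]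
  rfl

/-- The algebra `C*(ρ̂)` is contained in the closed direct sum `⨁ₖ B_k ⊗ υ_k`. -/
theorem mem_of_mem_cstarHat [T2Space X] {T : BigAlg S} (hT : T ∈ cstarHat hS) :
    T ∈ (Submodule.span ℂ (gradedTensors (Bspace hS))).topologicalClosure := by
  suffices h : cstarHat hS ≤ gradedAlgebra (Bspace hS) (Bspace_mul hS) (star_mem_Bspace hS) from
    h hT
  refine NonUnitalStarSubalgebra.topologicalClosure_minimal _ (NonUnitalStarAlgebra.adjoin_le ?_)
    isClosed_closure
  rintro _ (⟨a, rfl⟩ | ⟨f, rfl⟩)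
  · exact subset_closure (Submodule.subset_span ⟨0, _, rhoA_mem_Bspace hS a, rfl⟩)
  · exact subset_closure (Submodule.subset_span ⟨1, _, rhoE_mem_Bspace hS f, rfl⟩)

/-- The relative commutant of `ρ̂_A(A)` in `C*(ρ̂)` is contained in `D̂`: the Fourier coefficients
of an element commuting with `ρ̂_A(A)` commute with `ρ_A(A)`, hence are diagonal. -/
theorem mem_Dhat_of_commute [T2Space X] {T : BigAlg S} (hT : T ∈ cstarHat hS)
    (h : ∀ a, T * rhoHatA S a = rhoHatA S a * T) : T ∈ Dhat hS := by
  have hB := mem_of_mem_cstarHat hS hT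
  refine mem_of_fourierCoef_mem hB fun k => ⟨?_, ?_⟩
  · exact fourierCoef_mem k (Submodule.isClosed_topologicalClosure _) hB
  · refine mem_diagonal_of_commute S fun a => ?_
    rw [← fourierCoef_mul_opTensor_one, ← fourierCoef_opTensor_one_mul, ← rhoHatA_eq, h a]

/-- The space `D̂` as a `*`-subalgebra. -/
def DhatAlgebra [T2Space X] : NonUnitalStarSubalgebra ℂ (BigAlg S) :=
  gradedAlgebra (Dspace hS)
    (fun hα hβ => ⟨Bspace_mul hS hα.1 hβ.1, mul_mem_diagonal hα.2 hβ.2⟩)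
    (fun hα => ⟨star_mem_Bspace hS hα.1, star_mem_diagonal hα.2⟩)

theorem rhoHatA_mem_Dhat (a : C(X, ℂ)) : rhoHatA S a ∈ Dhat hS :=
  subset_closure (Submodule.subset_span
    ⟨0, _, ⟨rhoA_mem_Bspace hS a, rhoA_mem_diagonal S a⟩, rfl⟩)

theorem Dhat_subset_cstarHat [T2Space X] {T : BigAlg S} (hT : T ∈ Dhat hS) :
    T ∈ cstarHat hS := by
  refine Submodule.topologicalClosure_minimal _ (t := (cstarHat hS).toSubmodule)
    (Submodule.span_le.2 ?_) (NonUnitalStarSubalgebra.isClosed_topologicalClosure _) hT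
  rintro _ ⟨k, α, hα, rfl⟩
  exact opTensor_mem_cstarHat hS hα.1

theorem commute_of_mem_Dhat {P Q : BigAlg S} (hP : P ∈ Dhat hS) (hQ : Q ∈ Dhat hS) :
    P * Q = Q * P := by
  have hclosed : ∀ Q : BigAlg S, IsClosed {P : BigAlg S | P * Q = Q * P} := fun Q =>
    isClosed_eq (continuous_mul_const Q) (continuous_const_mul Q)
  have h1 : ∀ P ∈ gradedTensors (Dspace hS), ∀ Q ∈ gradedTensors (Dspace hS),
      Commute P Q := by
    rintro _ ⟨k, α, hα, rfl⟩ _ ⟨l, β, hβ, rfl⟩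
    change _ * _ = _ * _
    rw [opTensor_mul, opTensor_mul, upsilon_mul, upsilon_mul, commute_of_mem_diagonal hα.2 hβ.2,
      add_comm]
  have h2 : ∀ P ∈ Submodule.span ℂ (gradedTensors (Dspace hS)),
      ∀ Q ∈ Submodule.span ℂ (gradedTensors (Dspace hS)), Commute P Q := by
    intro P hP Q hQ
    induction hP, hQ using Submodule.span_induction₂ with
    | mem_mem P Q hP hQ => exact h1 P hP Q hQ
    | zero_left Q _ => exact Commute.zero_left _
    | zero_right P _ => exact Commute.zero_right _
    | add_left _ _ _ _ _ _ h h' => exact h.add_left h'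
    | add_right _ _ _ _ _ _ h h' => exact h.add_right h'
    | smul_left c _ _ _ _ h => exact h.smul_left c
    | smul_right c _ _ _ _ h => exact h.smul_right c
  refine closure_minimal (t := {P : BigAlg S | P * Q = Q * P}) (fun P' hP' => ?_) (hclosed Q) hP
  refine (closure_minimal (t := {Q : BigAlg S | Q * P' = P' * Q}) (fun Q' hQ' => ?_)
    (hclosed P') hQ).symm
  exact h2 Q' hQ' P' hP'

theorem isMasa_DhatAlgebra [T2Space X] : IsMasa (DhatAlgebra hS) (cstarHat hS) where
  isClosed := isClosed_closure
  maximal :=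
    ⟨⟨fun _ => Dhat_subset_cstarHat hS, fun _ hP _ hQ => commute_of_mem_Dhat hS hP hQ⟩,
      fun _ hM hle _ hT => mem_Dhat_of_commute hS (hM.1 hT) fun a =>
        hM.2 _ hT _ (hle (rhoHatA_mem_Dhat hS a))⟩

end Masa

end KW

end

theorem theorem5p5p1 {X : Type*} [TopologicalSpace X] [CompactSpace X] [T2Space X] {N : ℕ}
    (γ : Fin N → C(X, X)) (S : Set X) (hS : KW.IsRegularSubset γ S)
    (hγ : ∀ k, Topology.IsEmbedding (γ k))
    (U : Set X) (hU : KW.OpenSetCondition γ U) (hSU : S ⊆ U) (hcomeager : S ∈ residual X) :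
    ∃ D : NonUnitalStarSubalgebra ℂ (KW.BigAlg S),
      (D : Set (KW.BigAlg S)) = (KW.Dhat hS : Set (KW.BigAlg S)) ∧
      KW.IsMasa D (KW.cstarHat hS) ∧
      ∀ a : C(X, ℂ), KW.rhoHatA S a ∈ D :=
  ⟨KW.DhatAlgebra hS, rfl, KW.isMasa_DhatAlgebra hS, KW.rhoHatA_mem_Dhat hS⟩
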